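/- A \emph{standard multigraph} is a loopless multigraph $M$ in which every pair of vertices is joined by at most two edges; a pair joined by exactly one edge is called a \emph{light} edge. The degree of a vertex is the number of edges incident to it, counted with multiplicity, and $\delta(M)$ is the minimum degree. The \emph{complement} of $M$ is the standard multigraph on the same vertex set in which distinct vertices $x,y$ are joined by $2-\mu_M(xy)$ edges, where $\mu_M(xy)$ is the number of edges of $M$ joining them. A standard multigraph is \emph{acyclic} if it contains no cycles, where two parallel edges count as a cycle. A \emph{full clique} is the complement of an acyclic standard multigraph. Let $s$ be a positive integer and let $K$ be a full clique on $|K|\le s$ vertices. Call $K$ \emph{fit} if it has at most $\max\{0,\,|K|-s/2\}$ light edges. Call $K$ a \emph{near matching} if either every vertex of $K$ is in at most one light edge of $K$; or $|K|=s$, every vertex of $K$ is in at most two light edges of $K$, and at most one vertex of $K$ is in exactly two light edges of $K$. Call $K$ \emph{acceptable} if it is fit or a near matching. \textbf{Theorem.} For every integer $s\ge 1$ and every $\varepsilon>0$ there exists $n_0$ such that the following holds for every $n\ge n_0$ divisible by $s$. If $M$ is a standard multigraph on $n$ vertices with $$\delta(M)\ \ge\ 2\left(1-\frac1s\right)n+\varepsilon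 n,$$ then $M$ has a perfect tiling with acceptable $s$-cliques; that is, the vertex set of $M$ can be partitioned into sets of size $s$, each of which induces an acceptable full clique in $M$. -/

import Mathlib

/-- A standard multigraph on the vertex set `V`: a loopless multigraph in which every edge has
multiplicity at most `2`. It is given by its multiplicity function `mult x y`, the number of
edges joining `x` and `y`. -/
@[ext]
structure StdMultigraph (V : Type*) where
  mult : V → V → ℕ
  symm : ∀ x y, mult x y = mult y x
  loopless : ∀ x, mult x x = 0
  le_two : ∀ x y, mult x y ≤ 2

namespace StdMultigraph

/-- The degree of `v`: the number of edges at `v`, counted with multiplicity. -/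
def degree {V : Type*} [Fintype V] (M : StdMultigraph V) (v : V) : ℕ :=
  ∑ w, M.mult v w

/-- The minimum degree `δ(M)`. -/
noncomputable def minDegree {V : Type*} [Fintype V] (M : StdMultigraph V) : ℕ :=
  ⨅ v, M.degree v

/-- The graph `H(M)` of heavy edges, those of multiplicity `2`. -/
def heavy {V : Type*} (M : StdMultigraph V) : SimpleGraph V where
  Adj x y := M.mult x y = 2
  symm := ⟨fun x y h => by rw [M.symm]; exact h⟩
  loopless := ⟨fun x h => by simp [M.loopless x] at h⟩

/-- The graph `L(M)` of light edges, those of multiplicity `1`. -/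
def light {V : Type*} (M : StdMultigraph V) : SimpleGraph V where
  Adj x y := M.mult x y = 1
  symm := ⟨fun x y h => by rw [M.symm]; exact h⟩
  loopless := ⟨fun x h => by simp [M.loopless x] at h⟩

/-- The underlying simple graph `G(M) = H(M) ∪ L(M)`. -/
def underlying {V : Type*} (M : StdMultigraph V) : SimpleGraph V :=
  M.heavy ⊔ M.light

/-- `M` has no cycles, including `2`-cycles formed by the two edges of a heavy pair. -/
def IsAcyclic {V : Type*} (M : StdMultigraph V) : Prop :=
  M.underlying.IsAcyclic ∧ M.heavy = ⊥

open Classical in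
/-- The complement of `M`: distinct `x`, `y` are joined by `2 - M.mult x y` edges. -/
noncomputable def compl {V : Type*} (M : StdMultigraph V) : StdMultigraph V where
  mult x y := if x = y then 0 else 2 - M.mult x y
  symm x y := by simp only [eq_comm (a := x), M.symm x y]
  loopless x := by simp
  le_two x y := by split_ifs <;> omega

theorem compl_compl {V : Type*} (M : StdMultigraph V) : M.compl.compl = M := by
  ext x y
  by_cases h : x = y
  · subst h
    simp [compl, M.loopless]
  · have := M.le_two x y
    simp only [compl, h, if_false]
    omega

/-- The submultigraph `M[S]` induced by `S`. -/
def induce {V : Type*} (M : StdMultigraph V) (S : Finset V) : StdMultigraph S where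
  mult x y := M.mult x y
  symm x y := M.symm x y
  loopless x := M.loopless x
  le_two x y := M.le_two x y

/-- `K` is a full clique: the complement of an acyclic standard multigraph (complementation is
an involution). -/
def IsFullClique {W : Type*} (K : StdMultigraph W) : Prop :=
  K.compl.IsAcyclic

/-- The number of light edges of `K`. -/
noncomputable def numLight {W : Type*} (K : StdMultigraph W) : ℕ :=
  K.light.edgeSet.ncard

/-- The number of light edges of `K` at the vertex `v`. -/
noncomputable def lightDegree {W : Type*} (K : StdMultigraph W) (v : W) : ℕ :=
  (K.light.neighborSet v).ncard

/-- A full clique `K` on at most `s` vertices is fit if it has at most `max {0, |K| - s / 2}`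
light edges. -/
def IsFit {W : Type*} [Fintype W] (s : ℕ) (K : StdMultigraph W) : Prop :=
  K.IsFullClique ∧ Fintype.card W ≤ s ∧
    (K.numLight : ℝ) ≤ max 0 ((Fintype.card W : ℝ) - (s : ℝ) / 2)

/-- A full clique `K` on at most `s` vertices is a near matching if either all its light degrees
are at most `1`, or it has exactly `s` vertices, all its light degrees are at most `2`, and at
most one vertex has light degree `2`. -/
def IsNearMatching {W : Type*} [Fintype W] (s : ℕ) (K : StdMultigraph W) : Prop :=
  K.IsFullClique ∧ Fintype.card W ≤ s ∧
    ((∀ v, K.lightDegree v ≤ 1) ∨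
      (Fintype.card W = s ∧ (∀ v, K.lightDegree v ≤ 2) ∧
        ∀ v w, K.lightDegree v = 2 → K.lightDegree w = 2 → v = w))

/-- `K` is acceptable (with respect to `s`) if it is fit or a near matching. -/
def IsAcceptable {W : Type*} [Fintype W] (s : ℕ) (K : StdMultigraph W) : Prop :=
  IsFit s K ∨ IsNearMatching s K

/-- `T` is a perfect tiling of `M` with acceptable `s`-cliques: `T` consists of pairwise disjoint
vertex sets of size `s` that cover all vertices, each inducing an acceptable clique. -/
def IsPerfectAcceptableTiling {V : Type*} (s : ℕ) (M : StdMultigraph V)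
    (T : Finset (Finset V)) : Prop :=
  (T : Set (Finset V)).PairwiseDisjoint id ∧
    (∀ v : V, ∃ S ∈ T, v ∈ S) ∧
    ∀ S ∈ T, S.card = s ∧ IsAcceptable s (M.induce S)

end StdMultigraph

/-! Everything is carried out in the complement `N` of `M`. There full cliques become acyclic sets,
light edges of a full clique become its edges in `N`, and the degree condition says that every
degree is at most `(2/s - ε)n`. Since `weight` is twice the number of edges, a fit `s`-clique is a
forest of weight at most `s`. The one further type needed (`IsGood`) is a forest of weight `s + 1`
without isolated vertices; its degrees are all `1` except for a single `2`, so it is a near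
matching. The proof is by absorption.

Almost tiling (`exists_near_tiling`): take a packing by fit cliques of all sizes up to `s` that
maximizes the sum of `3^|K|`. A clique `X` of size `r < s` sends at least `2r/s` edges to each
vertex of any other clique that is not larger, since otherwise it could grow. The degree condition
therefore gives linearly many full cliques `Y` that receive fewer than `2r` edges from `X`, once the
intermediate sizes contribute little. If two `r`-cliques had the same degree pattern on such a `Y`,
then `exists_exchange` would turn sizes `r, r, s` into `r + 1, s` and raise the potential. So each
`Y` serves boundedly many `X`, and double counting bounds the number of cliques of each size below
`s`. The combinatorial core is `IsForestOn.exists_peelable`.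

Absorption: a gadget for `x, y` is a set that becomes tileable on adding either one. Gadgets joining
the vertices of an `s`-set `Q` to those of a good clique form an absorber for `Q` (`rich_absorbs`).
If every pair has many gadgets, greedy selection gives a small set that absorbs any single `s`-set,
and boundedly many disjoint copies absorb the bounded remainder of the almost tiling.

Gadgets: vertices without edges to the current set are available while it has at most `s/2`
vertices, and vertices with at most one edge while it has at most `s`. For even `s` this already
gives `s + 1` vertices from which `x` or `y` may be dropped. For odd `s` the count is one edge too
high. For `s = 3` the near matching clause repairs this, for `s = 5` a case analysis does. For `s ≥
7` each `x` has gadgets with more than half of all vertices (`many_reach_of_odd`), so any two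
vertices are linked through a third. -/

set_option linter.unusedSectionVars false

namespace StdMultigraph

/-! ### Forests, described by removing vertices of degree at most one. -/

section Peeling

variable {V : Type*} [DecidableEq V] (N : StdMultigraph V)

/-- The number of edges of `N` from `v` to `K`, with multiplicity. -/
def degIn (K : Finset V) (v : V) : ℕ := ∑ u ∈ K, N.mult v u

/-- Twice the number of edges of `N` inside `K`. -/
def weight (K : Finset V) : ℕ := ∑ v ∈ K, N.degIn K v

/-- `A` can be dismantled by removing vertices one at a time, each sending at most one edge to the
remaining ones, where `m v` further edges at `v` are counted from the outset. -/
def Peelable (m : V → ℕ) (A : Finset V) : Prop :=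
  ∀ B ⊆ A, B.Nonempty → ∃ v ∈ B, N.degIn B v + m v ≤ 1

/-- `N[K]` is acyclic. -/
def IsForestOn (K : Finset V) : Prop := N.Peelable (fun _ => 0) K

variable {N}

theorem degIn_mono {A B : Finset V} (h : A ⊆ B) (v : V) : N.degIn A v ≤ N.degIn B v :=
  Finset.sum_le_sum_of_subset h

theorem degIn_insert {K : Finset V} {z : V} (hz : z ∉ K) (v : V) :
    N.degIn (insert z K) v = N.mult v z + N.degIn K v :=
  Finset.sum_insert hz

theorem degIn_union {A B : Finset V} (h : Disjoint A B) (v : V) :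
    N.degIn (A ∪ B) v = N.degIn A v + N.degIn B v :=
  Finset.sum_union h

theorem mult_le_degIn {K : Finset V} {u : V} (hu : u ∈ K) (v : V) : N.mult v u ≤ N.degIn K v :=
  Finset.single_le_sum (f := fun u => N.mult v u) (fun _ _ => Nat.zero_le _) hu

theorem degIn_erase_self {K : Finset V} (v : V) : N.degIn (K.erase v) v = N.degIn K v := by
  by_cases hv : v ∈ K
  · rw [← Finset.insert_erase hv, degIn_insert (by simp), Finset.erase_insert (by simp),
      N.loopless, zero_add]
  · rw [Finset.erase_eq_of_notMem hv]

theorem sum_degIn_comm (A B : Finset V) :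
    ∑ a ∈ A, N.degIn B a = ∑ b ∈ B, N.degIn A b := by
  unfold degIn
  rw [Finset.sum_comm]
  exact Finset.sum_congr rfl fun b _ => Finset.sum_congr rfl fun a _ => N.symm a b

theorem weight_insert {K : Finset V} {z : V} (hz : z ∉ K) :
    N.weight (insert z K) = N.weight K + 2 * N.degIn K z := by
  unfold weight
  rw [Finset.sum_insert hz, degIn_insert hz, N.loopless,
    Finset.sum_congr rfl fun v _ => degIn_insert (N := N) hz v, Finset.sum_add_distrib]
  have : ∑ v ∈ K, N.mult v z = N.degIn K z := Finset.sum_congr rfl fun v _ => N.symm v z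
  omega

theorem weight_erase {K : Finset V} {z : V} (hz : z ∈ K) :
    N.weight (K.erase z) + 2 * N.degIn K z = N.weight K := by
  conv_rhs => rw [← Finset.insert_erase hz, weight_insert (by simp)]
  rw [degIn_erase_self]

theorem degIn_le_weight {K : Finset V} {v : V} (hv : v ∈ K) : N.degIn K v ≤ N.weight K :=
  Finset.single_le_sum (f := fun v => N.degIn K v) (fun _ _ => Nat.zero_le _) hv

theorem Peelable.mono {m : V → ℕ} {A B : Finset V} (h : N.Peelable m B) (hAB : A ⊆ B) :
    N.Peelable m A :=
  fun C hC => h C (hC.trans hAB)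

theorem Peelable.insert {m : V → ℕ} {A : Finset V} {v : V} (h : N.Peelable m A)
    (hv : N.degIn A v + m v ≤ 1) : N.Peelable m (insert v A) := by
  intro B hB hne
  by_cases hvB : v ∈ B
  · refine ⟨v, hvB, le_trans ?_ hv⟩
    have : N.degIn B v ≤ N.degIn A v := by
      rw [← degIn_erase_self]
      exact degIn_mono (fun u hu => by
        have := hB (Finset.mem_of_mem_erase hu)
        simpa [Finset.ne_of_mem_erase hu] using this) v
    omega
  · exact h B (fun u hu => by
      rcases Finset.mem_insert.1 (hB hu) with rfl | h
      · exact absurd hu hvB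
      · exact h) hne

theorem isForestOn_of_weight_eq_zero {K : Finset V} (h : N.weight K = 0) : N.IsForestOn K := by
  rintro B hB ⟨v, hv⟩
  refine ⟨v, hv, ?_⟩
  have := (degIn_mono (N := N) hB v).trans (degIn_le_weight (hB hv))
  simp only [add_zero]
  omega

/-- The vertices of `A` are removed first, with their edges to `X` counted as marks; what remains
lies in `X`. -/
theorem IsForestOn.union {X A : Finset V} (hX : N.IsForestOn X)
    (hA : N.Peelable (N.degIn X) A) : N.IsForestOn (X ∪ A) := by
  intro B hB hne
  by_cases hne' : (B \ X).Nonempty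
  · obtain ⟨v, hv, hv'⟩ := hA (B \ X) (fun u hu => by
      have h1 := Finset.mem_sdiff.1 hu
      exact (Finset.mem_union.1 (hB h1.1)).resolve_left h1.2) hne'
    refine ⟨v, (Finset.mem_sdiff.1 hv).1, ?_⟩
    have h1 : N.degIn B v ≤ N.degIn (B \ X ∪ X) v := degIn_mono (by simp) v
    rw [degIn_union Finset.sdiff_disjoint] at h1
    simp only [add_zero]
    omega
  · exact hX B (by simpa [Finset.sdiff_eq_empty_iff_subset] using hne') hne

/-- Each vertex of `A` peeled off takes at most one edge with it. -/
theorem weight_union_le {X A : Finset V} (hXA : Disjoint X A)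
    (hA : N.Peelable (N.degIn X) A) : N.weight (X ∪ A) ≤ N.weight X + 2 * A.card := by
  induction hn : A.card generalizing A with
  | zero => simp [Finset.card_eq_zero.1 hn]
  | succ n ih =>
    obtain ⟨v, hv, hv'⟩ := hA A subset_rfl (Finset.card_pos.1 (by omega))
    have hvX : v ∉ X := Finset.disjoint_right.1 hXA hv
    have h1 := ih (A := A.erase v) (hXA.mono_right (Finset.erase_subset _ _))
      (hA.mono (Finset.erase_subset _ _)) (by rw [Finset.card_erase_of_mem hv]; omega)
    have h2 : X ∪ A = insert v (X ∪ A.erase v) := by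
      rw [← Finset.union_insert, Finset.insert_erase hv]
    rw [h2, weight_insert (by simp [hvX]),
      degIn_union (hXA.mono_right (Finset.erase_subset _ _)), degIn_erase_self]
    omega

/-- From a forest with marks `m` one can delete at most half as many vertices as there are marks
so that each remaining component carries at most one mark. -/
theorem IsForestOn.exists_peelable {Y : Finset V} (hY : N.IsForestOn Y) (m : V → ℕ) :
    ∃ A ⊆ Y, 2 * Y.card ≤ 2 * A.card + ∑ y ∈ Y, m y ∧ N.Peelable m A := by
  induction hn : Y.card generalizing Y m with
  | zero =>
    exact ⟨∅, by simp, by simp, fun B hB hne => by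
      simp [Finset.subset_empty.1 hB] at hne⟩
  | succ n ih =>
    obtain ⟨v, hv, hv'⟩ := hY Y subset_rfl (Finset.card_pos.1 (by omega))
    have hcard : (Y.erase v).card = n := by rw [Finset.card_erase_of_mem hv]; omega
    have hY' : N.IsForestOn (Y.erase v) := hY.mono (Finset.erase_subset _ _)
    have hsum := Finset.add_sum_erase Y m hv
    -- Here `v` has degree at most one. With two or more marks it is deleted, and these marks pay
    -- for it. If degree and marks add up to at most one, it is kept. Otherwise it has one edge and
    -- one mark; it is kept and the mark is passed to its neighbour `u`.
    rcases le_or_gt 2 (m v) with h2 | h2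
    · obtain ⟨A, hA, hc, hp⟩ := ih hY' m hcard
      exact ⟨A, hA.trans (Finset.erase_subset _ _), by omega, hp⟩
    · by_cases h1 : N.degIn Y v + m v ≤ 1
      · obtain ⟨A, hA, hc, hp⟩ := ih hY' m hcard
        have hvA : v ∉ A := fun h => by simpa using hA h
        refine ⟨insert v A, ?_, ?_, hp.insert ?_⟩
        · exact Finset.insert_subset hv (hA.trans (Finset.erase_subset _ _))
        · rw [Finset.card_insert_of_notMem hvA]; omega
        · have := degIn_mono (N := N) (hA.trans (Finset.erase_subset _ _)) v
          omega
      · obtain ⟨u, hu, hu'⟩ : ∃ u ∈ Y, N.mult v u ≠ 0 := by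
          by_contra! hcon
          have : N.degIn Y v = 0 := Finset.sum_eq_zero hcon
          omega
        have huv : u ≠ v := by rintro rfl; exact hu' (N.loopless u)
        have hdeg : N.mult v u + N.degIn (Y.erase u) v = N.degIn Y v := by
          conv_rhs => rw [← Finset.insert_erase hu, degIn_insert (by simp)]
        have hu1 : N.mult v u = 1 := by omega
        obtain ⟨A, hA, hc, hp⟩ := ih hY' (m + Pi.single u 1) hcard
        have hvA : v ∉ A := fun h => by simpa using hA h
        have hvu : ∀ w ∈ A, w ≠ u → N.mult w v = 0 := by
          intro w hw hwu
          rw [N.symm]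
          have := mult_le_degIn (N := N) (K := Y.erase u)
            (Finset.mem_erase.2 ⟨hwu, Finset.mem_of_mem_erase (hA hw)⟩) v
          omega
        refine ⟨insert v A, Finset.insert_subset hv (hA.trans (Finset.erase_subset _ _)), ?_, ?_⟩
        · rw [Finset.card_insert_of_notMem hvA]
          simp only [Pi.add_apply, Finset.sum_add_distrib] at hc
          rw [Finset.sum_pi_single' u 1 (Y.erase v)] at hc
          split_ifs at hc <;> omega
        -- If `B` contains both `u` and `v`, the mark passed to `u` accounts for the edge `uv`. If
        -- `B` contains `v` but not `u`, then `v` is isolated in `B` and carries one mark.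
        · intro B hB hne
          by_cases hvB : v ∈ B
          · have hBA : B.erase v ⊆ A := fun w hw => by
              simpa [Finset.ne_of_mem_erase hw] using hB (Finset.mem_of_mem_erase hw)
            by_cases huB : u ∈ B
            · obtain ⟨w, hw, hw'⟩ := hp (B.erase v) hBA ⟨u, Finset.mem_erase.2 ⟨huv, huB⟩⟩
              refine ⟨w, Finset.mem_of_mem_erase hw, ?_⟩
              have : N.degIn B w = N.mult w v + N.degIn (B.erase v) w := by
                conv_lhs => rw [← Finset.insert_erase hvB, degIn_insert (by simp)]
              simp only [Pi.add_apply] at hw'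
              by_cases hwu : w = u
              · subst hwu
                have := N.symm w v
                simp only [Pi.single_eq_same] at hw'
                omega
              · have := hvu w (hBA hw) hwu
                omega
            · refine ⟨v, hvB, ?_⟩
              have : N.degIn B v ≤ N.degIn (Y.erase u) v := degIn_mono (fun w hw => by
                refine Finset.mem_erase.2 ⟨fun h => huB (h ▸ hw), ?_⟩
                rcases Finset.mem_insert.1 (hB hw) with rfl | h
                · exact hv
                · exact Finset.mem_of_mem_erase (hA h)) v
              omega
          · obtain ⟨w, hw, hw'⟩ := hp B (fun w hw => by
              rcases Finset.mem_insert.1 (hB hw) with rfl | h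
              · exact absurd hw hvB
              · exact h) hne
            exact ⟨w, hw, by simp only [Pi.add_apply] at hw'; omega⟩

end Peeling

/-! ### Exchanges between two small cliques and a full one. -/

section Exchange

variable {V : Type*} [DecidableEq V] (N : StdMultigraph V)

/-- `K` is a fit clique of the complement of `N`. -/
def IsFitOn (s : ℕ) (K : Finset V) : Prop :=
  K.card ≤ s ∧ N.IsForestOn K ∧ N.weight K ≤ 2 * K.card - s

variable {N}

theorem IsForestOn.insert_of_le {K : Finset V} {y : V} (hK : N.IsForestOn K)
    (hy : N.degIn K y ≤ 1) : N.IsForestOn (insert y K) :=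
  Peelable.insert hK (by simpa using hy)

/-- The allowance `2 * X.card - s` is truncated at zero. A new vertex buys one more edge once `2 *
X.card ≥ s`, but none while `2 * X.card < s`. -/
theorem IsFitOn.insert {s : ℕ} {X : Finset V} {y : V} (hX : N.IsFitOn s X) (hy : y ∉ X)
    (hs : X.card < s) (h1 : s ≤ 2 * X.card → N.degIn X y ≤ 1)
    (h0 : 2 * X.card < s → N.degIn X y = 0) : N.IsFitOn s (insert y X) := by
  have hle : N.degIn X y ≤ 1 := by
    rcases le_or_gt s (2 * X.card) with h | h
    · exact h1 h
    · rw [h0 h]; exact zero_le_one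
  refine ⟨by rw [Finset.card_insert_of_notMem hy]; omega, hX.2.1.insert_of_le hle, ?_⟩
  rw [Finset.card_insert_of_notMem hy, weight_insert hy]
  have := hX.2.2
  rcases le_or_gt s (2 * X.card) with h | h
  · omega
  · have := h0 h
    omega

/-- If few edges of `N` join `Y` to `X'`, then the vertices of `X' ∪ Y` can be rearranged so that
one of them becomes available to enlarge a copy `X` of `X'`. -/
theorem exists_exchange_of_le {s : ℕ} {X' Y : Finset V} (hX' : N.IsFitOn s X')
    (hr : X'.card < s) (hs : s ≤ 2 * X'.card) (hY : N.IsForestOn Y) (hYs : Y.card = s)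
    (hXY : Disjoint X' Y) (hsum : ∑ y ∈ Y, N.degIn X' y < 2 * X'.card) :
    ∃ y ∈ Y, N.degIn X' y ≤ 1 ∧ ∃ K ⊆ (X' ∪ Y).erase y, K.card = s ∧ N.IsFitOn s K := by
  -- Fewer than `2 * X'.card` marks leave more than `s - X'.card` vertices in `A`: enough to
  -- complete `X'` to size `s` and to spare `y`.
  obtain ⟨A, hAY, hc, hp⟩ := hY.exists_peelable (N.degIn X')
  obtain ⟨y, hy⟩ : A.Nonempty := Finset.card_pos.1 (by omega)
  obtain ⟨B, hBA, hB⟩ := Finset.exists_subset_card_eq (s := A.erase y) (n := s - X'.card)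
    (by rw [Finset.card_erase_of_mem hy]; omega)
  have hBY : B ⊆ Y := hBA.trans ((Finset.erase_subset _ _).trans hAY)
  have hpB := hp.mono (hBA.trans (Finset.erase_subset _ _))
  have hdis := hXY.mono_right hBY
  refine ⟨y, hAY hy, ?_, X' ∪ B, ?_, ?_, ?_, hX'.2.1.union hpB, ?_⟩
  · obtain ⟨v, hv, hv'⟩ := hp {y} (by simpa using hy) (by simp)
    rw [Finset.mem_singleton] at hv
    subst hv
    omega
  · intro u hu
    rcases Finset.mem_union.1 hu with h | h
    · exact Finset.mem_erase.2 ⟨fun e => Finset.disjoint_left.1 hXY h (e ▸ hAY hy),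
        Finset.mem_union_left _ h⟩
    · exact Finset.mem_erase.2 ⟨(Finset.mem_erase.1 (hBA h)).1,
        Finset.mem_union_right _ (hBY h)⟩
  · rw [Finset.card_union_of_disjoint hdis]; omega
  · rw [Finset.card_union_of_disjoint hdis]; omega
  · have := weight_union_le hdis hpB
    have := hX'.2.2
    rw [Finset.card_union_of_disjoint hdis]
    omega

/-- The companion of `exists_exchange_of_le` for cliques too small to carry an edge. Now the freed
vertex must send no edge at all to `X'`, so it is sought in the set `S` of such vertices of `Y`. -/
theorem exists_exchange_of_gt {s : ℕ} {X' Y : Finset V} (hX' : N.IsFitOn s X')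
    (hs : 2 * X'.card < s) (hY : N.IsFitOn s Y) (hYs : Y.card = s)
    (hXY : Disjoint X' Y) (hsum : ∑ y ∈ Y, N.degIn X' y < 2 * X'.card) :
    ∃ y ∈ Y, N.degIn X' y = 0 ∧ ∃ K ⊆ (X' ∪ Y).erase y, K.card = s ∧ N.IsFitOn s K := by
  have hwX : N.weight X' = 0 := by have := hX'.2.2; omega
  have hwY : N.weight Y ≤ s := by have := hY.2.2; omega
  set S := Y.filter fun y => N.degIn X' y = 0 with hS
  set R := Y.filter fun y => ¬ N.degIn X' y = 0 with hR
  have hSY : S ⊆ Y := Finset.filter_subset _ _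
  have hRY : R ⊆ Y := Finset.filter_subset _ _
  have hSR : S.card + R.card = s := by
    rw [← hYs]; exact Finset.card_filter_add_card_filter_not _
  have hsumR : ∑ y ∈ R, N.degIn X' y < 2 * X'.card :=
    (Finset.sum_le_sum_of_subset hRY).trans_lt hsum
  have hRcard : R.card ≤ ∑ y ∈ R, N.degIn X' y := by
    rw [Finset.card_eq_sum_ones]
    exact Finset.sum_le_sum fun y hy => Nat.one_le_iff_ne_zero.2 (Finset.mem_filter.1 hy).2
  have hSmem : ∀ {y}, y ∈ S → y ∈ Y ∧ N.degIn X' y = 0 := fun h => Finset.mem_filter.1 h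
  -- In this case `Y` can afford to lose `y` and gain one edge. On average a vertex of `X'` sends
  -- fewer than two edges to `Y`, so some `x` with at most one edge can replace `y`.
  by_cases hcase : ∃ y ∈ S, 1 ≤ N.degIn Y y ∨ N.weight Y + 2 ≤ s
  · obtain ⟨y, hyS, hy⟩ := hcase
    obtain ⟨x, hx, hx1⟩ : ∃ x ∈ X', N.degIn Y x < 2 := by
      apply Finset.exists_lt_of_sum_lt
      rw [sum_degIn_comm]
      simpa [mul_comm] using hsum
    have hxY : x ∉ Y := Finset.disjoint_left.1 hXY hx
    have hxY' : x ∉ Y.erase y := fun h => hxY (Finset.mem_of_mem_erase h)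
    have hyY := (hSmem hyS).1
    have hdeg : N.degIn (Y.erase y) x ≤ 1 := by
      have := degIn_mono (N := N) (Finset.erase_subset y Y) x
      omega
    have hcard : (insert x (Y.erase y)).card = s := by
      rw [Finset.card_insert_of_notMem hxY', Finset.card_erase_of_mem hyY]; omega
    refine ⟨y, hyY, (hSmem hyS).2, insert x (Y.erase y), ?_, hcard, hcard.le,
      IsForestOn.insert_of_le (hY.2.1.mono (Finset.erase_subset _ _)) hdeg, ?_⟩
    · intro u hu
      rcases Finset.mem_insert.1 hu with rfl | h
      · exact Finset.mem_erase.2 ⟨fun e => hxY (e ▸ hyY), Finset.mem_union_left _ hx⟩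
      · exact Finset.mem_erase.2 ⟨(Finset.mem_erase.1 h).1,
          Finset.mem_union_right _ (Finset.mem_erase.1 h).2⟩
    · rw [hcard, weight_insert hxY']
      have := weight_erase (N := N) hyY
      omega
  · push Not at hcase
    -- Otherwise the vertices of `S` are isolated in `X' ∪ Y`, and hence free to use. `X'` is
    -- completed from `S` without `y` and, if these do not suffice, from a peelable part `A` of the
    -- rest.
    have hiso : ∀ y ∈ S, N.degIn Y y = 0 := fun y hy => by have := (hcase y hy).1; omega
    have hmult : ∀ y ∈ S, ∀ u ∈ X' ∪ Y, N.mult u y = 0 := by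
      intro y hy u hu
      rw [N.symm]
      rcases Finset.mem_union.1 hu with h | h
      · have := mult_le_degIn (N := N) h y
        have := (hSmem hy).2
        omega
      · have := mult_le_degIn (N := N) h y
        have := hiso y hy
        omega
    obtain ⟨y, hy⟩ : S.Nonempty := Finset.card_pos.1 (by omega)
    obtain ⟨A, hAR, hc, hp⟩ := IsForestOn.exists_peelable (N := N) (hY.2.1.mono hRY) (N.degIn X')
    -- `R.card < 2 * X'.card` keeps `A₀` to at most `X'.card` vertices, so the final weight is at
    -- most `2 * X'.card < s`.
    obtain ⟨S₀, hS₀, A₀, hA₀, hcard, hA₀r⟩ : ∃ S₀ ⊆ S.erase y, ∃ A₀ ⊆ A,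
        S₀.card + A₀.card = s - X'.card ∧ A₀.card ≤ X'.card := by
      have hSy := Finset.card_erase_of_mem hy
      rcases le_or_gt (s - X'.card) (S.erase y).card with h | h
      · obtain ⟨S₀, h1, h2⟩ := Finset.exists_subset_card_eq h
        exact ⟨S₀, h1, ∅, by simp, by simp [h2], by simp⟩
      · obtain ⟨A₀, h1, h2⟩ := Finset.exists_subset_card_eq (s := A)
          (n := s - X'.card - (S.erase y).card) (by omega)
        exact ⟨S.erase y, subset_rfl, A₀, h1, by omega, by omega⟩
    have hS₀S : S₀ ⊆ S := hS₀.trans (Finset.erase_subset _ _)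
    have hA₀Y : A₀ ⊆ Y := hA₀.trans (hAR.trans hRY)
    have hdis : Disjoint X' S₀ := hXY.mono_right (hS₀S.trans hSY)
    have hdis2 : Disjoint (X' ∪ S₀) A₀ := by
      refine Finset.disjoint_union_left.2 ⟨hXY.mono_right hA₀Y, ?_⟩
      exact (Finset.disjoint_filter_filter_not Y Y _).mono hS₀S (hA₀.trans hAR)
    have hdegS : ∀ u ∈ X' ∪ Y, N.degIn S₀ u = 0 := fun u hu =>
      Finset.sum_eq_zero fun y hy => hmult y (hS₀S hy) u hu
    have hw0 : N.weight (X' ∪ S₀) = 0 := by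
      refine Finset.sum_eq_zero fun v hv => ?_
      rw [degIn_union hdis]
      rcases Finset.mem_union.1 hv with h | h
      · have := degIn_le_weight (N := N) h
        have := hdegS v (Finset.mem_union_left _ h)
        omega
      · have h1 := (hSmem (hS₀S h)).2
        have := hdegS v (Finset.mem_union_right _ (hSY (hS₀S h)))
        omega
    have hp' : N.Peelable (N.degIn (X' ∪ S₀)) A₀ := by
      intro B hB hne
      obtain ⟨v, hv, hv'⟩ := hp B (hB.trans hA₀) hne
      refine ⟨v, hv, ?_⟩
      rw [degIn_union hdis, hdegS v (Finset.mem_union_right _ (hA₀Y (hB hv)))]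
      omega
    have hcardK : (X' ∪ S₀ ∪ A₀).card = s := by
      rw [Finset.card_union_of_disjoint hdis2, Finset.card_union_of_disjoint hdis]; omega
    refine ⟨y, hSY hy, (hSmem hy).2, X' ∪ S₀ ∪ A₀, ?_, hcardK, hcardK.le,
      (isForestOn_of_weight_eq_zero hw0).union hp', ?_⟩
    · intro u hu
      rcases Finset.mem_union.1 hu with h | h
      · rcases Finset.mem_union.1 h with h | h
        · exact Finset.mem_erase.2 ⟨fun e => Finset.disjoint_left.1 hXY h (e ▸ hSY hy),
            Finset.mem_union_left _ h⟩
        · exact Finset.mem_erase.2 ⟨(Finset.mem_erase.1 (hS₀ h)).1,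
            Finset.mem_union_right _ (hSY (hS₀S h))⟩
      · refine Finset.mem_erase.2 ⟨?_, Finset.mem_union_right _ (hA₀Y h)⟩
        rintro rfl
        exact (Finset.mem_filter.1 (hAR (hA₀ h))).2 (hSmem hy).2
    · have := weight_union_le hdis2 hp'
      rw [hcardK]
      omega

theorem exists_exchange {s : ℕ} {X X' Y : Finset V} (hX : N.IsFitOn s X) (hX' : N.IsFitOn s X')
    (hcard : X.card = X'.card) (hr : X.card < s) (hY : N.IsFitOn s Y) (hYs : Y.card = s)
    (hXY : Disjoint X Y) (hXY' : Disjoint X' Y) (hpat : ∀ y ∈ Y, N.degIn X y = N.degIn X' y)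
    (hsum : ∑ y ∈ Y, N.degIn X y < 2 * X.card) :
    ∃ y ∈ Y, N.IsFitOn s (insert y X) ∧
      ∃ K ⊆ (X' ∪ Y).erase y, K.card = s ∧ N.IsFitOn s K := by
  have hsum' : ∑ y ∈ Y, N.degIn X' y < 2 * X'.card := by
    rwa [← hcard, ← Finset.sum_congr rfl hpat]
  rcases le_or_gt s (2 * X'.card) with h | h
  · obtain ⟨y, hy, h1, hK⟩ := exists_exchange_of_le hX' (hcard ▸ hr) h hY.2.1 hYs hXY' hsum'
    exact ⟨y, hy, hX.insert (fun h' => Finset.disjoint_left.1 hXY h' hy) hr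
      (fun _ => by rwa [hpat y hy]) (fun h' => by omega), hK⟩
  · obtain ⟨y, hy, h1, hK⟩ := exists_exchange_of_gt hX' h hY hYs hXY' hsum'
    exact ⟨y, hy, hX.insert (fun h' => Finset.disjoint_left.1 hXY h' hy) hr
      (fun h' => by omega) (fun _ => by rwa [hpat y hy]), hK⟩

end Exchange

/-! ### Packings of maximum potential. -/

section NearTiling

variable {V : Type*} [DecidableEq V] (N : StdMultigraph V)

/-- `T` consists of pairwise disjoint nonempty fit cliques inside `U`. -/
structure IsFitPacking (s : ℕ) (U : Finset V) (T : Finset (Finset V)) : Prop where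
  disj : (T : Set (Finset V)).PairwiseDisjoint id
  sub : ∀ K ∈ T, K ⊆ U
  nonempty : ∀ K ∈ T, K.Nonempty
  fit : ∀ K ∈ T, N.IsFitOn s K

/-- A potential that grows when two cliques of size `r` are traded for one of size `r + 1`. -/
def packingPotential (T : Finset (Finset V)) : ℕ := ∑ K ∈ T, 3 ^ K.card

variable {N}

theorem IsFitPacking.replace {s : ℕ} {U : Finset V} {T R A : Finset (Finset V)}
    (hT : N.IsFitPacking s U T) (hA : N.IsFitPacking s U A)
    (hAT : ∀ K ∈ A, ∀ L ∈ T, L ∉ R → Disjoint K L) :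
    N.IsFitPacking s U (T \ R ∪ A) := by
  have hmem : ∀ {K}, K ∈ T \ R ∪ A → (K ∈ T ∧ K ∉ R) ∨ K ∈ A := by
    intro K hK
    simpa using hK
  refine ⟨?_, fun K hK => ?_, fun K hK => ?_, fun K hK => ?_⟩
  · intro K hK L hL hKL
    rcases hmem (Finset.mem_coe.1 hK) with h | h <;> rcases hmem (Finset.mem_coe.1 hL) with h' | h'
    · exact hT.disj h.1 h'.1 hKL
    · exact (hAT L h' K h.1 h.2).symm
    · exact hAT K h L h'.1 h'.2
    · exact hA.disj h h' hKL
  · exact (hmem hK).elim (fun h => hT.sub K h.1) (hA.sub K)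
  · exact (hmem hK).elim (fun h => hT.nonempty K h.1) (hA.nonempty K)
  · exact (hmem hK).elim (fun h => hT.fit K h.1) (hA.fit K)

theorem packingPotential_replace {s : ℕ} {U : Finset V} {T R A : Finset (Finset V)}
    (hRT : R ⊆ T) (hA : N.IsFitPacking s U A)
    (hAT : ∀ K ∈ A, ∀ L ∈ T, L ∉ R → Disjoint K L) :
    packingPotential (T \ R ∪ A) + packingPotential R
      = packingPotential T + packingPotential A := by
  have hd : Disjoint (T \ R) A := by
    rw [Finset.disjoint_left]
    intro K hK hKA
    have h := Finset.mem_sdiff.1 hK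
    have := hAT K hKA K h.1 h.2
    exact (hA.nonempty K hKA).ne_empty (by simpa using this)
  unfold packingPotential
  rw [Finset.sum_union hd, add_right_comm, Finset.sum_sdiff hRT]

theorem exists_max_isFitPacking (s : ℕ) (U : Finset V) :
    ∃ T, N.IsFitPacking s U T ∧
      ∀ T', N.IsFitPacking s U T' → packingPotential T' ≤ packingPotential T := by
  classical
  have hfin : ((U.powerset.powerset.filter fun T => N.IsFitPacking s U T)).Nonempty :=
    ⟨∅, by simp; exact ⟨by simp, by simp, by simp, by simp⟩⟩
  obtain ⟨T, hT, hmax⟩ := Finset.exists_max_image _ packingPotential hfin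
  refine ⟨T, (Finset.mem_filter.1 hT).2, fun T' hT' => hmax T' (Finset.mem_filter.2 ⟨?_, hT'⟩)⟩
  exact Finset.mem_powerset.2 fun K hK => Finset.mem_powerset.2 (hT'.sub K hK)

/-- A packing by fit cliques of maximum potential. -/
structure IsMaxFitPacking (N : StdMultigraph V) (s : ℕ) (U : Finset V) (T : Finset (Finset V)) :
    Prop extends N.IsFitPacking s U T where
  max : ∀ T', N.IsFitPacking s U T' → packingPotential T' ≤ packingPotential T

theorem IsMaxFitPacking.potential_le {s : ℕ} {U : Finset V} {T R A : Finset (Finset V)}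
    (hT : IsMaxFitPacking N s U T) (hRT : R ⊆ T) (hA : N.IsFitPacking s U A)
    (hAT : ∀ K ∈ A, ∀ L ∈ T, L ∉ R → Disjoint K L) :
    packingPotential A ≤ packingPotential R := by
  have h1 := packingPotential_replace hRT hA hAT
  have h2 := hT.max _ (hT.toIsFitPacking.replace hA hAT)
  omega

theorem isFitPacking_singleton {s : ℕ} {U K : Finset V} (hKU : K ⊆ U) (hne : K.Nonempty)
    (hK : N.IsFitOn s K) : N.IsFitPacking s U {K} :=
  ⟨by simp, by simpa using hKU, by simpa using hne, by simpa using hK⟩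

theorem isFitPacking_pair {s : ℕ} {U K L : Finset V} (hKU : K ⊆ U) (hne : K.Nonempty)
    (hK : N.IsFitOn s K) (hLU : L ⊆ U) (hneL : L.Nonempty)
    (hL : N.IsFitOn s L) (hKL : Disjoint K L) : N.IsFitPacking s U {K, L} := by
  refine ⟨?_, by simp [hKU, hLU], by simp [hne, hneL], by simp [hK, hL]⟩
  intro A hA B hB hAB
  simp only [Finset.coe_insert, Finset.coe_singleton, Set.mem_insert_iff,
    Set.mem_singleton_iff] at hA hB
  rcases hA with rfl | rfl <;> rcases hB with rfl | rfl
  · exact absurd rfl hAB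
  · exact hKL
  · exact hKL.symm
  · exact absurd rfl hAB

/-- A singleton is a fit clique, so an uncovered vertex could be added to the packing. -/
theorem IsMaxFitPacking.biUnion_eq {s : ℕ} (hs : 1 ≤ s) {U : Finset V} {T : Finset (Finset V)}
    (hT : IsMaxFitPacking N s U T) : T.biUnion id = U := by
  apply subset_antisymm
  · exact Finset.biUnion_subset.2 hT.sub
  · intro u hu
    by_contra hcon
    simp only [Finset.mem_biUnion, id, not_exists, not_and] at hcon
    have hw : N.weight {u} = 0 := by simp [weight, degIn, N.loopless]
    have hfit : N.IsFitOn s {u} :=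
      ⟨by simpa using hs, isForestOn_of_weight_eq_zero hw, by simp [hw]⟩
    have := hT.potential_le (R := ∅) (by simp)
      (isFitPacking_singleton (by simpa using hu) (by simp) hfit)
      (by simpa using hcon)
    simp [packingPotential] at this

/-- Moving `y` to `X` and discarding the rest of `L` would still raise the potential, because `3 ^
L.card + 3 ^ X.card < 3 ^ (X.card + 1)`. -/
theorem IsMaxFitPacking.not_fit_insert {s : ℕ} {U : Finset V} {T : Finset (Finset V)}
    (hT : IsMaxFitPacking N s U T) {X L : Finset V} (hX : X ∈ T) (hL : L ∈ T)
    (hLX : L ≠ X) (hcard : L.card ≤ X.card) {y : V} (hy : y ∈ L) :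
    ¬ N.IsFitOn s (insert y X) := by
  intro hfit
  have hyX : y ∉ X := Finset.disjoint_left.1 (hT.disj hL hX hLX) hy
  have := hT.potential_le (R := {X, L}) (A := {insert y X})
    (by simp [Finset.insert_subset_iff, hX, hL])
    (isFitPacking_singleton (Finset.insert_subset (hT.sub L hL hy) (hT.sub X hX)) (by simp) hfit)
    (by
      intro K hK M hM hMR
      rw [Finset.mem_singleton] at hK
      subst hK
      simp only [Finset.mem_insert, Finset.mem_singleton, not_or] at hMR
      refine Finset.disjoint_insert_left.2 ⟨?_, hT.disj hX hM (Ne.symm hMR.1)⟩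
      exact Finset.disjoint_left.1 (hT.disj hL hM (Ne.symm hMR.2)) hy)
  unfold packingPotential at this
  rw [Finset.sum_singleton, Finset.sum_pair hLX.symm, Finset.card_insert_of_notMem hyX] at this
  have h3 : (3 : ℕ) ^ L.card ≤ 3 ^ X.card := Nat.pow_le_pow_right (by norm_num) hcard
  have h4 : 0 < (3 : ℕ) ^ X.card := by positivity
  rw [pow_succ] at this
  omega

/-- Otherwise the exchange replaces sizes `r, r, s` by `r + 1, s`, and `2 * 3 ^ r < 3 ^ (r + 1)`.
The common pattern lets one vertex `y` serve both purposes: it is chosen with the help of `X'` and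
added to `X`. -/
theorem IsMaxFitPacking.eq_of_same_pattern {s : ℕ} {U : Finset V} {T : Finset (Finset V)}
    (hT : IsMaxFitPacking N s U T) {X X' Y : Finset V} (hX : X ∈ T) (hX' : X' ∈ T) (hY : Y ∈ T)
    (hcard : X.card = X'.card) (hr : X.card < s) (hYs : Y.card = s)
    (hpat : ∀ y ∈ Y, N.degIn X y = N.degIn X' y)
    (hsum : ∑ y ∈ Y, N.degIn X y < 2 * X.card) : X = X' := by
  by_contra hne
  have hXY : X ≠ Y := by rintro rfl; omega
  have hXY' : X' ≠ Y := by rintro rfl; omega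
  have dXX' : Disjoint X X' := hT.disj hX hX' hne
  have dXY : Disjoint X Y := hT.disj hX hY hXY
  have dXY' : Disjoint X' Y := hT.disj hX' hY hXY'
  obtain ⟨y, hy, hfit, K, hK, hKs, hKfit⟩ := exists_exchange (hT.fit X hX) (hT.fit X' hX') hcard hr
    (hT.fit Y hY) hYs dXY dXY' hpat hsum
  have hyX : y ∉ X := Finset.disjoint_right.1 dXY hy
  have hKsub : K ⊆ X' ∪ Y := hK.trans (Finset.erase_subset _ _)
  have hyK : y ∉ K := fun h => by simpa using hK h
  have hdis : Disjoint (insert y X) K :=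
    Finset.disjoint_insert_left.2 ⟨hyK,
      (Finset.disjoint_union_right.2 ⟨dXX', dXY⟩).mono_right hKsub⟩
  have := hT.potential_le (R := {X, X', Y}) (A := {insert y X, K})
    (by simp [Finset.insert_subset_iff, hX, hX', hY])
    (isFitPacking_pair (Finset.insert_subset (hT.sub Y hY hy) (hT.sub X hX)) (by simp) hfit
      (hKsub.trans (Finset.union_subset (hT.sub X' hX') (hT.sub Y hY)))
      (Finset.card_pos.1 (by omega)) hKfit hdis)
    (by
      intro L hL M hM hMR
      simp only [Finset.mem_insert, Finset.mem_singleton, not_or] at hMR hL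
      have h1 := hT.disj hX hM (Ne.symm hMR.1)
      have h2 := hT.disj hX' hM (Ne.symm hMR.2.1)
      have h3 := hT.disj hY hM (Ne.symm hMR.2.2)
      rcases hL with rfl | rfl
      · exact Finset.disjoint_insert_left.2 ⟨Finset.disjoint_left.1 h3 hy, h1⟩
      · exact (Finset.disjoint_union_left.2 ⟨h2, h3⟩).mono_left hKsub)
  unfold packingPotential at this
  have hne2 : insert y X ≠ K := by rintro rfl; simp at hyK
  rw [Finset.sum_pair hne2, Finset.sum_insert (by simp [hne, hXY]), Finset.sum_pair hXY',
    Finset.card_insert_of_notMem hyX, hKs, hYs, ← hcard, pow_succ] at this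
  have h4 : 0 < (3 : ℕ) ^ X.card := by positivity
  omega

end NearTiling

/-! ### Counting the small cliques of a maximum packing. -/

section NearTilingCount

variable {V : Type*} [DecidableEq V] {N : StdMultigraph V}

/-- A vertex `y` of `L` with fewer than `2 * X.card / s` edges to `X` would have at most one, and
none when `2 * X.card < s`; either way it could be added to `X`. -/
theorem IsMaxFitPacking.sum_degIn_ge {s : ℕ} {U : Finset V} {T : Finset (Finset V)}
    (hT : IsMaxFitPacking N s U T) {X L : Finset V} (hX : X ∈ T) (hr : X.card < s) (hL : L ∈ T)
    (hLX : L ≠ X) (hcard : L.card ≤ X.card) :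
    2 * X.card * L.card ≤ s * ∑ y ∈ L, N.degIn X y := by
  rw [Finset.mul_sum, mul_comm, ← smul_eq_mul]
  refine Finset.card_nsmul_le_sum _ _ _ fun y hy => ?_
  have hyX : y ∉ X := Finset.disjoint_left.1 (hT.disj hL hX hLX) hy
  by_contra hcon
  push Not at hcon
  refine hT.not_fit_insert hX hL hLX hcard hy ((hT.fit X hX).insert hyX hr (fun h => ?_) fun h => ?_)
  · by_contra h1
    have : s * 2 ≤ s * N.degIn X y := Nat.mul_le_mul_left _ (by omega)
    omega
  · by_contra h1
    have : s * 1 ≤ s * N.degIn X y := Nat.mul_le_mul_left _ (by omega)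
    omega

/-- The degree condition puts the edges from `X` to `U` below `2 * X.card * U.card / s` by a linear
amount. Only `X` itself, cliques of intermediate size and full cliques with few edges to `X` can
account for this deficit. -/
theorem IsMaxFitPacking.card_mul_le {s : ℕ} (hs : 1 ≤ s) {U : Finset V} {T : Finset (Finset V)}
    (hT : IsMaxFitPacking N s U T) {X : Finset V} (hX : X ∈ T) (hr : X.card < s) {ε : ℝ}
    (hdeg : ∀ v ∈ U, (N.degIn U v : ℝ) ≤ (2 / s - ε) * U.card) :
    s * ε * U.card ≤ 2 * (X.card + ∑ L ∈ T with X.card < L.card ∧ L.card < s, L.card +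
      s * (T.filter fun Y => Y.card = s ∧ ∑ y ∈ Y, N.degIn X y < 2 * X.card).card : ℕ) := by
  have hr0 : 0 < X.card := Finset.card_pos.2 (hT.nonempty X hX)
  set r := X.card with hrdef
  have hU := hT.biUnion_eq hs
  have hsum (f : V → ℕ) : ∑ y ∈ U, f y = ∑ L ∈ T, ∑ y ∈ L, f y := by
    rw [← hU]; exact Finset.sum_biUnion hT.disj
  have hcardU : U.card = ∑ L ∈ T, L.card := by
    rw [Finset.card_eq_sum_ones, hsum]; simp
  have key : ∀ L ∈ T, 2 * r * L.card ≤ s * ∑ y ∈ L, N.degIn X y +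
      2 * r * ((if L = X then r else 0) + (if r < L.card ∧ L.card < s then L.card else 0) +
        s * (if L.card = s ∧ ∑ y ∈ L, N.degIn X y < 2 * r then 1 else 0)) := by
    intro L hL
    by_cases hLX : L = X
    · subst hLX
      simp only [if_true, ← hrdef]
      have : 2 * r * r ≤ 2 * r * (r + (if r < r ∧ r < s then r else 0) +
        s * (if r = s ∧ ∑ y ∈ L, N.degIn L y < 2 * r then 1 else 0)) :=
        Nat.mul_le_mul_left _ (by omega)
      omega
    rcases le_or_gt L.card r with h | h
    · exact (hT.sum_degIn_ge hX hr hL hLX h).trans (Nat.le_add_right _ _)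
    rcases (hT.fit L hL).1.lt_or_eq with h' | h'
    · refine le_trans ?_ (Nat.le_add_left _ _)
      refine Nat.mul_le_mul_left _ ?_
      rw [if_pos (⟨h, h'⟩ : r < L.card ∧ L.card < s)]
      omega
    · by_cases hg : ∑ y ∈ L, N.degIn X y < 2 * r
      · refine le_trans ?_ (Nat.le_add_left _ _)
        refine Nat.mul_le_mul_left _ ?_
        rw [if_pos (⟨h', hg⟩ : L.card = s ∧ _)]
        omega
      · refine le_trans ?_ (Nat.le_add_right _ _)
        rw [h', mul_comm]
        exact Nat.mul_le_mul_left _ (by omega)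
  have htot := Finset.sum_le_sum key
  rw [← Finset.mul_sum, ← hcardU, Finset.sum_add_distrib, ← Finset.mul_sum, ← hsum,
    ← Finset.mul_sum, Finset.sum_add_distrib, Finset.sum_add_distrib, ← Finset.mul_sum,
    Finset.sum_ite_eq' T X, if_pos hX, ← Finset.sum_filter, ← Finset.card_filter,
    sum_degIn_comm] at htot
  set B := r + ∑ L ∈ T with r < L.card ∧ L.card < s, L.card +
      s * (T.filter fun Y => Y.card = s ∧ ∑ y ∈ Y, N.degIn X y < 2 * r).card with hB
  have hdegX : ((∑ x ∈ X, N.degIn U x : ℕ) : ℝ) ≤ r * ((2 / s - ε) * U.card) := by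
    push_cast
    rw [hrdef, ← nsmul_eq_mul]
    exact Finset.sum_le_card_nsmul _ _ _ fun x hx => hdeg x (hT.sub X hX hx)
  have htot' : (2 * r * U.card : ℝ) ≤ s * (∑ x ∈ X, N.degIn U x : ℕ) + 2 * r * (B : ℕ) := by
    exact_mod_cast htot
  have hs0 : (0 : ℝ) < s := by exact_mod_cast hs
  have hr0' : (0 : ℝ) < r := by exact_mod_cast hr0
  have h1 : (s : ℝ) * (r * ((2 / s - ε) * U.card)) = r * (2 * U.card - s * ε * U.card) := by
    field_simp
  have h2 : (s : ℝ) * (∑ x ∈ X, N.degIn U x : ℕ) ≤ r * (2 * U.card - s * ε * U.card) := by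
    rw [← h1]; exact mul_le_mul_of_nonneg_left hdegX hs0.le
  have h3 : (r : ℝ) * (s * ε * U.card) ≤ r * (2 * B) := by linarith
  exact le_of_mul_le_mul_left h3 hr0'

/-- Distinct such `X` have distinct degree patterns on `Y`, and a pattern is a function from `Y` to
numbers below `2 * s`. -/
theorem IsMaxFitPacking.card_good_le {s : ℕ} {U : Finset V} {T : Finset (Finset V)}
    (hT : IsMaxFitPacking N s U T) {Y : Finset V} (hY : Y ∈ T) (hYs : Y.card = s) {r : ℕ}
    (hr : r < s) :
    (T.filter fun X => X.card = r ∧ ∑ y ∈ Y, N.degIn X y < 2 * r).card ≤ (2 * s) ^ s := by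
  classical
  have : (2 * s) ^ s = (Finset.univ : Finset (Y → Fin (2 * s))).card := by
    simp [hYs]
  rw [this]
  have hlt : ∀ X ∈ T.filter fun X => X.card = r ∧ ∑ y ∈ Y, N.degIn X y < 2 * r, ∀ y ∈ Y,
      N.degIn X y < 2 * s := by
    intro X hX y hy
    have h1 := (Finset.mem_filter.1 hX).2.2
    have h2 := Finset.single_le_sum (f := fun y => N.degIn X y) (fun _ _ => Nat.zero_le _) hy
    omega
  refine Finset.card_le_card_of_injOn
    (fun X y => if h : N.degIn X y < 2 * s then ⟨N.degIn X y, h⟩ else ⟨0, by omega⟩)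
    (fun _ _ => Finset.mem_coe.2 (Finset.mem_univ _)) ?_
  intro X hX X' hX' hXX'
  have hXm := Finset.mem_filter.1 (Finset.mem_coe.1 hX)
  have hXm' := Finset.mem_filter.1 (Finset.mem_coe.1 hX')
  refine hT.eq_of_same_pattern hXm.1 hXm'.1 hY (hXm.2.1.trans hXm'.2.1.symm)
    (by omega) hYs (fun y hy => ?_) (by rw [hXm.2.1]; exact hXm.2.2)
  have h1 := congrFun hXX' ⟨y, hy⟩
  simp only [dif_pos (hlt X hX y hy), dif_pos (hlt X' hX' y hy), Fin.mk.injEq] at h1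
  exact h1

/-- A maximum packing has boundedly many cliques of each size smaller than `s`. -/
theorem IsMaxFitPacking.card_filter_le {s : ℕ} (hs : 1 ≤ s) {ε : ℝ} (hε : 0 < ε) {C : ℕ}
    (hC : 4 * (2 * s : ℝ) ^ s / ε ≤ C) {U : Finset V} (hU : 4 * (s + s * s * C) ≤ s * ε * U.card)
    (hdeg : ∀ v ∈ U, (N.degIn U v : ℝ) ≤ (2 / s - ε) * U.card) {T : Finset (Finset V)}
    (hT : IsMaxFitPacking N s U T) {r : ℕ} (hr : r < s) :
    (T.filter fun X => X.card = r).card ≤ C := by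
  -- Larger sizes come first, so that the contribution of the cliques of intermediate size is
  -- already bounded.
  induction hk : s - r using Nat.strong_induction_on generalizing r with
  | _ k ih =>
  subst hk
  have hs0 : (0 : ℝ) < s := by exact_mod_cast hs
  have hUpos : (0 : ℝ) < U.card := by
    by_contra hcon
    have h1 : (U.card : ℝ) = 0 := le_antisymm (not_lt.1 hcon) (Nat.cast_nonneg _)
    rw [h1, mul_zero] at hU
    have : (0 : ℝ) ≤ s * s * C := by positivity
    linarith
  have hmid : ∑ L ∈ T with r < L.card ∧ L.card < s, L.card ≤ s * s * C := by
    have h1 : ∑ L ∈ T with r < L.card ∧ L.card < s, L.card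
        ≤ ∑ q ∈ Finset.range s, ∑ L ∈ (T.filter fun L => r < L.card ∧ L.card < s) with
          L.card = q, L.card := by
      rw [Finset.sum_fiberwise_of_maps_to]
      intro L hL
      exact Finset.mem_range.2 (Finset.mem_filter.1 hL).2.2
    refine h1.trans ?_
    rw [mul_assoc]
    refine (Finset.sum_le_card_nsmul _ _ (s * C) fun q hq => ?_).trans (by simp)
    rw [Finset.mem_range] at hq
    by_cases hqr : r < q
    · refine (Finset.sum_le_card_nsmul _ _ s fun L hL => ?_).trans ?_
      · rw [(Finset.mem_filter.1 hL).2]; exact hq.le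
      · rw [smul_eq_mul, mul_comm]
        refine Nat.mul_le_mul_left _ (le_trans (Finset.card_le_card ?_)
          (ih (s - q) (by omega) hq rfl))
        intro L hL
        simp only [Finset.mem_filter] at hL ⊢
        exact ⟨hL.1.1, hL.2⟩
    · rw [Finset.sum_eq_zero]
      · exact Nat.zero_le _
      · intro L hL
        simp only [Finset.mem_filter] at hL
        omega
  set Tr := T.filter fun X => X.card = r with hTr
  set Ts := T.filter fun X => X.card = s with hTs
  -- Every `X` of size `r` has linearly many full cliques with few edges to it. Each full clique is
  -- counted for at most `(2 * s) ^ s` sets `X`, so double counting makes `Tr` bounded.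
  have hgood : ∀ X ∈ Tr, ε * U.card / 4 ≤
      ((Ts.filter fun Y => ∑ y ∈ Y, N.degIn X y < 2 * r).card : ℝ) := by
    intro X hX
    obtain ⟨hXT, hXr⟩ := Finset.mem_filter.1 hX
    have h1 := hT.card_mul_le hs hXT (hXr ▸ hr) hdeg
    rw [hXr] at h1
    rw [hTs, Finset.filter_filter]
    set b := (T.filter fun Y => Y.card = s ∧ ∑ y ∈ Y, N.degIn X y < 2 * r).card
    have h2 : ((r + ∑ L ∈ T with r < L.card ∧ L.card < s, L.card + s * b : ℕ) : ℝ)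
        ≤ s + s * s * C + s * b := by
      have : r + ∑ L ∈ T with r < L.card ∧ L.card < s, L.card + s * b
        ≤ s + s * s * C + s * b := by omega
      exact_mod_cast this
    have h3 : (s : ℝ) * (ε * U.card) ≤ s * (4 * b) := by nlinarith
    have := le_of_mul_le_mul_left h3 hs0
    linarith
  have hdouble : ∑ X ∈ Tr, (Ts.filter fun Y => ∑ y ∈ Y, N.degIn X y < 2 * r).card
      = ∑ Y ∈ Ts, (Tr.filter fun X => ∑ y ∈ Y, N.degIn X y < 2 * r).card := by
    simp only [Finset.card_filter]
    exact Finset.sum_comm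
  have hTsU : Ts.card ≤ U.card := by
    have h1 : T.card ≤ ∑ L ∈ T, L.card := by
      rw [Finset.card_eq_sum_ones]
      exact Finset.sum_le_sum fun L hL => Finset.card_pos.2 (hT.nonempty L hL)
    have h2 : ∑ L ∈ T, L.card = U.card := by
      conv_rhs => rw [← hT.biUnion_eq hs]
      exact (Finset.card_biUnion fun K hK L hL h => hT.disj hK hL h).symm
    exact (Finset.card_filter_le _ _).trans (h1.trans h2.le)
  have hupper : ∑ Y ∈ Ts, (Tr.filter fun X => ∑ y ∈ Y, N.degIn X y < 2 * r).card
      ≤ U.card * (2 * s) ^ s := by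
    refine (Finset.sum_le_card_nsmul _ _ ((2 * s) ^ s) fun Y hY => ?_).trans
      (Nat.mul_le_mul_right _ hTsU)
    obtain ⟨hYT, hYs⟩ := Finset.mem_filter.1 hY
    rw [hTr, Finset.filter_filter]
    exact hT.card_good_le hYT hYs hr
  have hlower : (Tr.card : ℝ) * (ε * U.card / 4) ≤
      ((∑ X ∈ Tr, (Ts.filter fun Y => ∑ y ∈ Y, N.degIn X y < 2 * r).card : ℕ) : ℝ) := by
    push_cast
    rw [← nsmul_eq_mul]
    exact Finset.card_nsmul_le_sum _ _ _ hgood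
  rw [hdouble] at hlower
  have h5 : (Tr.card : ℝ) * (ε * U.card / 4) ≤ U.card * (2 * s) ^ s :=
    hlower.trans (by exact_mod_cast hupper)
  have h6 : (Tr.card : ℝ) ≤ 4 * (2 * s : ℝ) ^ s / ε := by
    rw [le_div_iff₀ hε]
    have : (U.card : ℝ) * (Tr.card * ε) ≤ U.card * (4 * (2 * s) ^ s) := by linarith
    exact le_of_mul_le_mul_left this hUpos
  exact_mod_cast h6.trans hC

/-- Fit `s`-cliques cover all but boundedly many vertices. -/
theorem exists_near_tiling {s : ℕ} (hs : 1 ≤ s) {ε : ℝ} (hε : 0 < ε) {C : ℕ}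
    (hC : 4 * (2 * s : ℝ) ^ s / ε ≤ C) {U : Finset V} (hU : 4 * (s + s * s * C) ≤ s * ε * U.card)
    (hdeg : ∀ v ∈ U, (N.degIn U v : ℝ) ≤ (2 / s - ε) * U.card) :
    ∃ T : Finset (Finset V), (T : Set (Finset V)).PairwiseDisjoint id ∧
      (∀ K ∈ T, K ⊆ U ∧ K.card = s ∧ N.IsFitOn s K) ∧ (U \ T.biUnion id).card ≤ s * (s * C) := by
  obtain ⟨T, hT, hmax⟩ := N.exists_max_isFitPacking s U
  have hT' : IsMaxFitPacking N s U T := ⟨hT, hmax⟩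
  refine ⟨T.filter fun X => X.card = s, hT.disj.subset (Finset.coe_subset.2 (Finset.filter_subset _ _)), fun K hK => ?_, ?_⟩
  · obtain ⟨h1, h2⟩ := Finset.mem_filter.1 hK
    exact ⟨hT.sub K h1, h2, hT.fit K h1⟩
  · have hsub : U \ (T.filter fun X => X.card = s).biUnion id ⊆
        (Finset.range s).biUnion fun q => (T.filter fun X => X.card = q).biUnion id := by
      intro u hu
      obtain ⟨hu1, hu2⟩ := Finset.mem_sdiff.1 hu
      rw [← hT'.biUnion_eq hs] at hu1
      obtain ⟨L, hL, huL⟩ := Finset.mem_biUnion.1 hu1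
      simp only [Finset.mem_biUnion, Finset.mem_range, Finset.mem_filter]
      refine ⟨L.card, lt_of_le_of_ne (hT.fit L hL).1 fun h => hu2 ?_, L, ⟨hL, rfl⟩, huL⟩
      exact Finset.mem_biUnion.2 ⟨L, Finset.mem_filter.2 ⟨hL, h⟩, huL⟩
    refine (Finset.card_le_card hsub).trans ?_
    refine (Finset.card_biUnion_le_card_mul _ _ (s * C) fun q hq => ?_).trans (by simp)
    have hq' := Finset.mem_range.1 hq
    refine (Finset.card_biUnion_le_card_mul _ _ s fun L hL => ?_).trans ?_
    · exact ((Finset.mem_filter.1 hL).2.trans_lt hq').le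
    · rw [mul_comm]
      exact Nat.mul_le_mul_left _ (hT'.card_filter_le hs hε hC hU hdeg hq')

end NearTilingCount

/-! ### Robust existence: choosing lists entry by entry. -/

section Rich

variable {V : Type*} [Fintype V] [DecidableEq V]

/-- At least `c` elements satisfy `p`. -/
def Many (c : ℝ) (p : V → Prop) : Prop := c ≤ ({v | p v}.ncard : ℝ)

/-- Lists of length `k` with property `P` can be chosen entry by entry with at least `c` choices
for each entry. -/
def Rich (c : ℝ) : ℕ → (List V → Prop) → Prop
  | 0, P => P []
  | k + 1, P => Many c fun v => Rich c k fun l => P (v :: l)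

theorem Many.mono {c c' : ℝ} {p q : V → Prop} (h : Many c p) (hc : c' ≤ c) (hpq : ∀ v, p v → q v) :
    Many c' q :=
  hc.trans (h.trans (by exact_mod_cast Set.ncard_le_ncard (fun v hv => hpq v hv) (Set.toFinite _)))

theorem Many.exists {c : ℝ} {p : V → Prop} (h : Many c p) (hc : 0 < c) : ∃ v, p v := by
  have h1 : (0 : ℝ) < ({v | p v}.ncard : ℝ) := hc.trans_le h
  have h2 : 0 < {v | p v}.ncard := by exact_mod_cast h1
  exact (Set.ncard_pos (Set.toFinite _)).1 h2

theorem Many.avoid {c : ℝ} {p : V → Prop} (h : Many c p) (F : Finset V) :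
    Many (c - F.card) fun v => p v ∧ v ∉ F := by
  unfold Many at h ⊢
  have h1 : {v | p v} ⊆ {v | p v ∧ v ∉ F} ∪ (F : Set V) := fun v hv => by
    by_cases hF : v ∈ F
    · exact Or.inr hF
    · exact Or.inl ⟨hv, hF⟩
  have h2 : {v | p v}.ncard ≤ {v | p v ∧ v ∉ F}.ncard + F.card := by
    rw [← Set.ncard_coe_finset F]
    exact (Set.ncard_le_ncard h1 (Set.toFinite _)).trans (Set.ncard_union_le _ _)
  have h3 : ({v | p v}.ncard : ℝ) ≤ {v | p v ∧ v ∉ F}.ncard + F.card := by exact_mod_cast h2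
  linarith

theorem Many.or {c : ℝ} {p q : V → Prop} (h : Many c fun v => p v ∨ q v) :
    Many (c / 2) p ∨ Many (c / 2) q := by
  by_contra! hcon
  unfold Many at h hcon
  have h2 : {v | p v ∨ q v}.ncard ≤ {v | p v}.ncard + {v | q v}.ncard :=
    Set.ncard_union_le {v | p v} {v | q v}
  have h3 : ({v | p v ∨ q v}.ncard : ℝ) ≤ {v | p v}.ncard + {v | q v}.ncard := by exact_mod_cast h2
  linarith [hcon.1, hcon.2]

/-- There are at least `α * β` related pairs. With threshold `γ = α * β / (2 * n)`, where `n` is the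
number of vertices, the `b` below it cover at most `γ * n` pairs; fewer than `γ` others would cover
fewer than `γ * n`. -/
theorem Many.swap {α β : ℝ} (hα : 0 ≤ α) (hβ : 0 ≤ β) {R : V → V → Prop}
    (h : Many α fun v => Many β fun b => R v b) :
    Many (α * β / (2 * Fintype.card V)) fun b =>
      Many (α * β / (2 * Fintype.card V)) fun v => R v b := by
  classical
  set n : ℝ := ((Fintype.card V : ℕ) : ℝ) with hn
  rcases eq_or_ne n 0 with h0 | h0
  · simp only [h0, mul_zero, div_zero, Many, Nat.cast_nonneg, Set.ofPred_true]
  have hn0 : 0 < n := lt_of_le_of_ne (by positivity) h0.symm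
  set γ := α * β / (2 * n) with hγ
  have hγ0 : 0 ≤ γ := by positivity
  have hcount (p : V → Prop) : {v | p v}.ncard = (Finset.univ.filter p).card := by
    rw [← Set.ncard_coe_finset]; simp
  have hle (p : V → Prop) : ({v | p v}.ncard : ℝ) ≤ n := by
    rw [hcount, hn]; exact_mod_cast Finset.card_le_univ _
  by_contra hcon
  unfold Many at h hcon
  push Not at hcon
  have hdouble : (∑ v : V, ({b | R v b}.ncard : ℝ)) = ∑ b : V, ({v | R v b}.ncard : ℝ) := by
    simp only [hcount, Finset.card_filter]
    push_cast
    exact Finset.sum_comm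
  have hlower : α * β ≤ ∑ v : V, ({b | R v b}.ncard : ℝ) := by
    rw [hcount] at h
    calc α * β ≤ (Finset.univ.filter fun v => β ≤ ({b | R v b}.ncard : ℝ)).card * β :=
          mul_le_mul_of_nonneg_right h hβ
      _ ≤ ∑ v ∈ Finset.univ.filter fun v => β ≤ ({b | R v b}.ncard : ℝ), ({b | R v b}.ncard : ℝ) := by
          rw [← nsmul_eq_mul]
          exact Finset.card_nsmul_le_sum _ _ _ fun v hv => (Finset.mem_filter.1 hv).2
      _ ≤ _ := Finset.sum_le_sum_of_subset_of_nonneg (Finset.filter_subset _ _)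
          fun _ _ _ => by positivity
  have hupper : ∑ b : V, ({v | R v b}.ncard : ℝ) <  γ * n + n * γ := by
    rw [← Finset.sum_filter_add_sum_filter_not Finset.univ
      (fun b => γ ≤ ({v | R v b}.ncard : ℝ))]
    rw [hcount] at hcon
    refine add_lt_add_of_lt_of_le ?_ ?_
    · refine (Finset.sum_le_card_nsmul _ _ n fun b _ => hle _).trans_lt ?_
      rw [nsmul_eq_mul]
      exact mul_lt_mul_of_pos_right hcon hn0
    · refine (Finset.sum_le_card_nsmul _ _ γ fun b hb => ?_).trans ?_
      · exact (not_le.1 (Finset.mem_filter.1 hb).2).le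
      · rw [nsmul_eq_mul]
        refine mul_le_mul_of_nonneg_right ?_ hγ0
        rw [hn]; exact_mod_cast Finset.card_le_univ _
  have : γ * n + n * γ = α * β := by rw [hγ]; field_simp; ring
  rw [this, ← hdouble] at hupper
  linarith

theorem Rich.mono {c c' : ℝ} (hc : c' ≤ c) {k : ℕ} {P Q : List V → Prop} (h : Rich c k P)
    (hPQ : ∀ l, l.length = k → P l → Q l) : Rich c' k Q := by
  induction k generalizing P Q with
  | zero => exact hPQ [] rfl h
  | succ k ih =>
    exact Many.mono h hc fun v hv => ih hv fun l hl => hPQ (v :: l) (by simp [hl])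

theorem Rich.append {c : ℝ} {m k : ℕ} {P : List V → Prop} {Q : List V → List V → Prop}
    (h : Rich c k P) (hQ : ∀ l, l.length = k → P l → Rich c m (Q l)) :
    Rich c (m + k) fun l => ∃ l₁ l₂, l = l₁ ++ l₂ ∧ l₁.length = k ∧ l₂.length = m ∧
      P l₁ ∧ Q l₁ l₂ := by
  induction k generalizing P Q with
  | zero => exact (hQ [] rfl h).mono le_rfl fun l hl hq => ⟨[], l, rfl, rfl, hl, h, hq⟩
  | succ k ih =>
    refine Many.mono h le_rfl fun v hv => ?_
    refine (ih hv fun l hl hp => hQ (v :: l) (by simp [hl]) hp).mono le_rfl ?_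
    rintro l hl ⟨l₁, l₂, rfl, h1, h2, h3, h4⟩
    exact ⟨v :: l₁, l₂, rfl, by simp [h1], h2, h3, h4⟩

/-- Each choice excludes `F` and the entries already chosen, at most `F.card + k` vertices. -/
theorem Rich.avoid {c : ℝ} {k : ℕ} {P : List V → Prop} (h : Rich c k P) (F : Finset V) :
    Rich (c - F.card - k) k fun l => P l ∧ l.Nodup ∧ ∀ v ∈ l, v ∉ F := by
  induction k generalizing P F with
  | zero => exact ⟨h, by simp, by simp⟩
  | succ k ih =>
    refine Many.mono (Many.avoid h F) ?_ ?_
    · push_cast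
      have : (0 : ℝ) ≤ k := Nat.cast_nonneg k
      linarith
    · rintro v ⟨hv, hvF⟩
      refine (ih hv (insert v F)).mono ?_ ?_
      · rw [Finset.card_insert_of_notMem hvF]
        push_cast
        linarith
      · rintro l - ⟨h1, h2, h3⟩
        refine ⟨h1, ?_, ?_⟩
        · rw [List.nodup_cons]
          exact ⟨fun hvl => by simpa using h3 v hvl, h2⟩
        · intro w hw
          rcases List.mem_cons.1 hw with rfl | hw
          · exact hvF
          · exact fun hwF => h3 w hw (Finset.mem_insert_of_mem hwF)

theorem Rich.or {c : ℝ} {k : ℕ} {P Q : List V → Prop}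
    (h : Rich c k fun l => P l ∨ Q l) : Rich (c / 2) k P ∨ Rich (c / 2) k Q := by
  induction k generalizing P Q with
  | zero => exact h
  | succ k ih => exact Many.or (Many.mono h le_rfl fun v hv => ih hv)

/-- Moves the choice of `b` from after the list to before it. Each entry that `b` passes costs a
factor `δ / 2`, by `Many.swap`. -/
theorem Rich.swap {δ : ℝ} (h0 : 0 ≤ δ) (h1 : δ ≤ 1) {k : ℕ} {Q : V → List V → Prop}
    (h : Rich (δ * Fintype.card V) k fun l => Many (δ * Fintype.card V) fun b => Q b l) :
    Many (δ * (δ / 2) ^ k * Fintype.card V) fun b =>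
      Rich (δ * (δ / 2) ^ k * Fintype.card V) k (Q b) := by
  set n : ℝ := ((Fintype.card V : ℕ) : ℝ) with hn
  have hn0 : 0 ≤ n := Nat.cast_nonneg _
  induction k generalizing Q with
  | zero =>
    rw [pow_zero, mul_one]
    exact h
  | succ k ih =>
    have h2 : Many (δ * n) fun v => Many (δ * (δ / 2) ^ k * n) fun b =>
        Rich (δ * (δ / 2) ^ k * n) k fun l => Q b (v :: l) :=
      Many.mono h le_rfl fun v hv => ih hv
    have h3 := Many.swap (by positivity) (by positivity) h2
    rw [← hn] at h3
    have h4 : δ * n * (δ * (δ / 2) ^ k * n) / (2 * n) = δ * (δ / 2) ^ (k + 1) * n := by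
      rcases eq_or_ne n 0 with h | h
      · simp [h]
      · field_simp; ring
    rw [h4] at h3
    have h5 : δ * (δ / 2) ^ (k + 1) * n ≤ δ * (δ / 2) ^ k * n := by
      refine mul_le_mul_of_nonneg_right (mul_le_mul_of_nonneg_left ?_ h0) hn0
      exact pow_le_pow_of_le_one (by linarith) (by linarith) (Nat.le_succ k)
    exact h3.mono le_rfl fun b hb => hb.mono le_rfl fun v hv => hv.mono h5 fun l _ hl => hl

open Classical in
-- Averaging over each entry in turn: some vertex is a valid choice for a proportion `δ` of the
-- remaining objects.
theorem Rich.select {ι : Type*} {δ : ℝ} (h0 : 0 ≤ δ) (hn : 0 < Fintype.card V) {k : ℕ}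
    {P : ι → List V → Prop} {O : Finset ι}
    (h : ∀ o ∈ O, Rich (δ * Fintype.card V) k (P o)) :
    ∃ l : List V, l.length = k ∧ δ ^ k * O.card ≤ (O.filter fun o => P o l).card := by
  induction k generalizing P O with
  | zero =>
    refine ⟨[], rfl, ?_⟩
    have h' : (O.filter fun o => P o []) = O := Finset.filter_true_of_mem h
    simp [h']
  | succ k ih =>
    set n : ℝ := ((Fintype.card V : ℕ) : ℝ) with hnn
    have hn0 : 0 < n := by rw [hnn]; exact_mod_cast hn
    obtain ⟨v, hv⟩ : ∃ v : V, δ * O.card ≤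
        (O.filter fun o => Rich (δ * n) k fun l => P o (v :: l)).card := by
      by_contra! hcon
      have h1 : ∑ v : V, ((O.filter fun o => Rich (δ * n) k fun l => P o (v :: l)).card : ℝ)
          < n * (δ * O.card) := by
        refine (Finset.sum_lt_sum_of_nonempty (Finset.univ_nonempty_iff.2
          (Fintype.card_pos_iff.1 hn)) fun v _ => hcon v).trans_le ?_
        simp [hnn]
      have h2 : ∑ v : V, ((O.filter fun o => Rich (δ * n) k fun l => P o (v :: l)).card : ℝ)
          = ∑ o ∈ O, ({v | Rich (δ * n) k fun l => P o (v :: l)}.ncard : ℝ) := by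
        have hcount (p : V → Prop) : {v | p v}.ncard = (Finset.univ.filter p).card := by
          rw [← Set.ncard_coe_finset]; simp
        simp only [hcount, Finset.card_filter]
        push_cast
        exact Finset.sum_comm
      have h3 : (O.card : ℝ) * (δ * n) ≤
          ∑ o ∈ O, ({v | Rich (δ * n) k fun l => P o (v :: l)}.ncard : ℝ) := by
        rw [← nsmul_eq_mul]
        exact Finset.card_nsmul_le_sum _ _ _ h
      rw [h2] at h1
      nlinarith
    obtain ⟨l, hl, hl'⟩ := ih (P := fun o l => P o (v :: l))
      (O := O.filter fun o => Rich (δ * n) k fun l => P o (v :: l))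
      fun o ho => (Finset.mem_filter.1 ho).2
    refine ⟨v :: l, by simp [hl], ?_⟩
    calc δ ^ (k + 1) * O.card = δ ^ k * (δ * O.card) := by ring
      _ ≤ δ ^ k * (O.filter fun o => Rich (δ * n) k fun l => P o (v :: l)).card :=
        mul_le_mul_of_nonneg_left hv (by positivity)
      _ ≤ _ := hl'
      _ ≤ _ := by
        gcongr
        exact Finset.filter_subset _ _

end Rich

/-! ### Gadgets, absorbers and their greedy selection. -/

section Absorbing

variable {V : Type*} [DecidableEq V]

/-- `B` is a disjoint union of members of `G`. -/
inductive Tileable (G : Finset V → Prop) : Finset V → Prop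
  | empty : Tileable G ∅
  | union (K B : Finset V) : G K → Disjoint K B → Tileable G B → Tileable G (K ∪ B)

variable {G : Finset V → Prop}

theorem Tileable.of_mem {K : Finset V} (hK : G K) : Tileable G K := by
  simpa using Tileable.union K ∅ hK (by simp) Tileable.empty

theorem Tileable.disjUnion {A B : Finset V} (hA : Tileable G A) (hB : Tileable G B)
    (h : Disjoint A B) : Tileable G (A ∪ B) := by
  induction hA with
  | empty => simpa using hB
  | union K A hK hKA _ ih =>
    rw [Finset.disjoint_union_left] at h
    rw [Finset.union_assoc]
    exact .union _ _ hK (Finset.disjoint_union_right.2 ⟨hKA, h.1⟩) (ih h.2)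

theorem Tileable.biUnion {T : Finset (Finset V)} (hT : (T : Set (Finset V)).PairwiseDisjoint id)
    (hG : ∀ K ∈ T, G K) : Tileable G (T.biUnion id) := by
  induction T using Finset.induction_on with
  | empty => simpa using Tileable.empty
  | insert K T hK ih =>
    rw [Finset.biUnion_insert]
    refine .union _ _ (hG K (by simp)) ?_
      (ih (hT.subset (by simp)) fun L hL => hG L (by simp [hL]))
    rw [Finset.disjoint_biUnion_right]
    intro L hL
    exact hT (by simp) (by simp [hL]) (by rintro rfl; exact hK hL)

theorem Tileable.dvd_card {s : ℕ} (hG : ∀ K, G K → K.card = s) {A : Finset V}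
    (hA : Tileable G A) : s ∣ A.card := by
  induction hA with
  | empty => simp
  | union K A hK hKA _ ih =>
    rw [Finset.card_union_of_disjoint hKA, hG K hK]
    exact (Nat.dvd_add_right dvd_rfl).2 ih

theorem Tileable.exists_partition {A : Finset V} (hA : Tileable G A) : ∃ T : Finset (Finset V), (T : Set (Finset V)).PairwiseDisjoint id ∧
      T.biUnion id = A ∧ ∀ K ∈ T, G K := by
  induction hA with
  | empty => exact ⟨∅, by simp, by simp, by simp⟩
  | union K A hK hKA _ ih =>
    obtain ⟨T, h1, h2, h3⟩ := ih
    refine ⟨insert K T, ?_, by rw [Finset.biUnion_insert, h2, id], ?_⟩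
    · rw [Finset.coe_insert, Set.pairwiseDisjoint_insert]
      refine ⟨h1, fun L hL _ => hKA.mono_right ?_⟩
      rw [← h2]
      exact Finset.subset_biUnion_of_mem id (Finset.mem_coe.1 hL)
    · intro L hL
      rcases Finset.mem_insert.1 hL with rfl | h
      · exact hK
      · exact h3 L h

/-- Adding either `x` or `y` to `l` gives a tileable set. -/
def Gadget (G : Finset V → Prop) (x y : V) (l : List V) : Prop :=
  Tileable G (insert x l.toFinset) ∧ Tileable G (insert y l.toFinset)

/-- `l` is tileable both with and without `Q`. -/
def Absorbs (G : Finset V → Prop) (Q : Finset V) (l : List V) : Prop :=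
  Tileable G l.toFinset ∧ Disjoint l.toFinset Q ∧ Tileable G (l.toFinset ∪ Q)

variable [Fintype V]

/-- Gadgets for the pairs are chosen one after another, each avoiding `F` and the earlier ones.
Their tilings with all first, or all second, entries are then disjoint. -/
theorem rich_gadgets {c c₀ : ℝ} {k : ℕ} (hgad : ∀ x y, x ≠ y → Rich c₀ k (Gadget G x y))
    (L : List (V × V)) (F : Finset V) (hF : ∀ p ∈ L, p.1 ∈ F ∧ p.2 ∈ F)
    (h1 : (L.map Prod.fst).Nodup) (h2 : (L.map Prod.snd).Nodup) (hne : ∀ p ∈ L, p.1 ≠ p.2)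
    (hc : c + F.card + L.length * k ≤ c₀) :
    Rich c (L.length * k) fun l => (∀ v ∈ l, v ∉ F) ∧
      Tileable G (l.toFinset ∪ (L.map Prod.fst).toFinset) ∧
      Tileable G (l.toFinset ∪ (L.map Prod.snd).toFinset) := by
  induction L generalizing F with
  | nil =>
    rw [List.length_nil, zero_mul]
    exact ⟨by simp, by simpa using Tileable.empty, by simpa using Tileable.empty⟩
  | cons p L ih =>
    obtain ⟨x, y⟩ := p
    have hxF : x ∈ F := (hF (x, y) (by simp)).1
    have hyF : y ∈ F := (hF (x, y) (by simp)).2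
    simp only [List.map_cons, List.nodup_cons] at h1 h2
    rw [List.length_cons] at hc ⊢
    rw [Nat.succ_mul]
    push_cast at hc
    have hk0 : (0 : ℝ) ≤ k := Nat.cast_nonneg k
    have hLk0 : (0 : ℝ) ≤ L.length * k := by positivity
    have hfirst : Rich c k fun l => Gadget G x y l ∧ l.Nodup ∧ ∀ v ∈ l, v ∉ F :=
      ((hgad x y (hne (x, y) (by simp))).avoid F).mono (by linarith) fun l _ hl => hl
    refine (hfirst.append (Q := fun l₁ l₂ => (∀ v ∈ l₂, v ∉ F ∪ l₁.toFinset) ∧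
      Tileable G (l₂.toFinset ∪ (L.map Prod.fst).toFinset) ∧
      Tileable G (l₂.toFinset ∪ (L.map Prod.snd).toFinset)) ?_).mono le_rfl ?_
    · rintro l hl -
      refine ih (F ∪ l.toFinset) (fun p hp => ?_) h1.2 h2.2 (fun p hp => hne p (by simp [hp])) ?_
      · have := hF p (by simp [hp])
        exact ⟨Finset.mem_union_left _ this.1, Finset.mem_union_left _ this.2⟩
      · have : (F ∪ l.toFinset).card ≤ F.card + k := by
          refine (Finset.card_union_le _ _).trans ?_
          have := l.toFinset_card_le
          omega
        have : ((F ∪ l.toFinset).card : ℝ) ≤ F.card + k := by exact_mod_cast this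
        linarith
    · rintro _ - ⟨l₁, l₂, rfl, -, -, ⟨⟨hx, hy⟩, -, hl₁F⟩, hl₂F, ht1, ht2⟩
      have key : ∀ (z : V) (q : List V), z ∈ F → (∀ w ∈ q, w ∈ F) → z ∉ q →
          Tileable G (insert z l₁.toFinset) → Tileable G (l₂.toFinset ∪ q.toFinset) →
          Tileable G ((l₁ ++ l₂).toFinset ∪ (z :: q).toFinset) := by
        intro z q hzF hqF hzq hz hq
        have heq : (l₁ ++ l₂).toFinset ∪ (z :: q).toFinset =
            insert z l₁.toFinset ∪ (l₂.toFinset ∪ q.toFinset) := by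
          ext w
          simp only [List.toFinset_append, List.toFinset_cons, Finset.mem_union, Finset.mem_insert]
          tauto
        rw [heq]
        refine hz.disjUnion hq ?_
        rw [Finset.disjoint_left]
        intro w hw hw'
        simp only [Finset.mem_insert, Finset.mem_union, List.mem_toFinset] at hw hw'
        rcases hw with rfl | hw <;> rcases hw' with hw' | hw'
        · exact hl₂F w hw' (Finset.mem_union_left _ hzF)
        · exact hzq hw'
        · exact hl₂F w hw' (Finset.mem_union_right _ (List.mem_toFinset.2 hw))
        · exact hl₁F w hw (hqF w hw')
      refine ⟨?_, key x _ hxF ?_ h1.1 hx ht1, key y _ hyF ?_ h2.1 hy ht2⟩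
      · intro v hv
        rcases List.mem_append.1 hv with h | h
        · exact hl₁F v h
        · exact fun hvF => hl₂F v h (Finset.mem_union_left _ hvF)
      · intro w hw
        obtain ⟨p, hp, rfl⟩ := List.mem_map.1 hw
        exact (hF p (by simp [hp])).1
      · intro w hw
        obtain ⟨p, hp, rfl⟩ := List.mem_map.1 hw
        exact (hF p (by simp [hp])).2

/-- A clique `p` is matched with `Q` and each pair joined by a gadget. Without `Q` the gadgets take
up the vertices of `p`; with `Q` they take up `Q`, and `p` is a tile by itself. -/
theorem rich_absorbs {c c₀ : ℝ} {s k : ℕ} (hgad : ∀ x y, x ≠ y → Rich c₀ k (Gadget G x y))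
    (hcl : Rich c₀ s fun l => G l.toFinset) {Q : Finset V} (hQ : Q.card = s)
    (hc : c + 2 * s + s * k ≤ c₀) : Rich c (s * k + s) (Absorbs G Q) := by
  have hs0 : (0 : ℝ) ≤ s := Nat.cast_nonneg s
  have hsk0 : (0 : ℝ) ≤ s * k := by positivity
  have hfirst : Rich c s fun l => G l.toFinset ∧ l.Nodup ∧ ∀ v ∈ l, v ∉ Q :=
    (hcl.avoid Q).mono (by rw [hQ]; linarith) fun l _ hl => hl
  refine (hfirst.append (Q := fun p l => (∀ v ∈ l, v ∉ Q ∪ p.toFinset) ∧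
      Tileable G (l.toFinset ∪ Q) ∧ Tileable G (l.toFinset ∪ p.toFinset)) ?_).mono le_rfl ?_
  · rintro p hp ⟨-, hnd, hpQ⟩
    have hlen : Q.toList.length = p.length := by rw [Finset.length_toList, hQ, hp]
    have hfst : (Q.toList.zip p).map Prod.fst = Q.toList := List.map_fst_zip hlen.le
    have hsnd : (Q.toList.zip p).map Prod.snd = p := List.map_snd_zip hlen.ge
    have hL : (Q.toList.zip p).length = s := by
      rw [List.length_zip, hlen, min_self, hp]
    have h := rich_gadgets (c := c) hgad (Q.toList.zip p) (Q ∪ p.toFinset) (fun q hq => ?_)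
      (by rw [hfst]; exact Q.nodup_toList) (by rwa [hsnd]) (fun q hq => ?_) ?_
    · rw [hfst, hsnd, hL, Finset.toList_toFinset] at h
      exact h
    · have := List.of_mem_zip (a := q.1) (b := q.2) hq
      exact ⟨Finset.mem_union_left _ (Finset.mem_toList.1 this.1),
        Finset.mem_union_right _ (List.mem_toFinset.2 this.2)⟩
    · have := List.of_mem_zip (a := q.1) (b := q.2) hq
      intro h
      exact hpQ _ this.2 (h ▸ Finset.mem_toList.1 this.1)
    · have : (Q ∪ p.toFinset).card ≤ 2 * s := by
        refine (Finset.card_union_le _ _).trans ?_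
        have := p.toFinset_card_le
        omega
      have : ((Q ∪ p.toFinset).card : ℝ) ≤ 2 * s := by exact_mod_cast this
      rw [hL]
      linarith
  · rintro _ - ⟨p, l, rfl, -, -, ⟨hG, hnd, hpQ⟩, hl, ht1, ht2⟩
    have hpQ' : Disjoint p.toFinset Q :=
      Finset.disjoint_left.2 fun v hv => hpQ v (List.mem_toFinset.1 hv)
    have hl' : Disjoint l.toFinset (Q ∪ p.toFinset) :=
      Finset.disjoint_left.2 fun v hv => hl v (List.mem_toFinset.1 hv)
    rw [Finset.disjoint_union_right] at hl'
    refine ⟨?_, ?_, ?_⟩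
    · rwa [List.toFinset_append, Finset.union_comm]
    · rw [List.toFinset_append]
      exact Finset.disjoint_union_left.2 ⟨hpQ', hl'.1⟩
    · rw [List.toFinset_append, Finset.union_assoc]
      exact .union _ _ hG (Finset.disjoint_union_right.2 ⟨hl'.2.symm, hpQ'⟩) ht1

open Classical in
-- A greedy substitute for random selection: each round appends one list that absorbs a proportion
-- at least `δ ^ k` of the sets `Q` not yet absorbed.
theorem exists_partial_absorber {δ : ℝ} (hδ : 0 ≤ δ) (hδ1 : δ ≤ 1) {s k m : ℕ}
    (hn : 0 < Fintype.card V)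
    (habs : ∀ Q : Finset V, Q.card = s → Rich (2 * δ * Fintype.card V) k (Absorbs G Q))
    (F : Finset V) (hF : (F.card + (m + 1) * k : ℝ) ≤ δ * Fintype.card V) (j : ℕ) (hj : j ≤ m) :
    ∃ A : Finset V, Disjoint A F ∧ A.card ≤ j * k ∧ Tileable G A ∧
      (((Finset.powersetCard s Finset.univ).filter fun Q =>
        Disjoint Q A ∧ ¬ Tileable G (A ∪ Q)).card : ℝ) ≤
          (1 - δ ^ k) ^ j * (Fintype.card V : ℝ) ^ s := by
  induction j with
  | zero =>
    refine ⟨∅, by simp, by simp, .empty, ?_⟩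
    rw [pow_zero, one_mul]
    have : ((Finset.powersetCard s (Finset.univ : Finset V)).filter fun Q =>
        Disjoint Q ∅ ∧ ¬ Tileable G (∅ ∪ Q)).card ≤ Fintype.card V ^ s :=
      (Finset.card_filter_le _ _).trans (by
        rw [Finset.card_powersetCard, Finset.card_univ]; exact Nat.choose_le_pow _ _)
    exact_mod_cast this
  | succ j ih =>
    obtain ⟨A, hAF, hAc, hAt, hA⟩ := ih (by omega)
    set O := (Finset.powersetCard s (Finset.univ : Finset V)).filter fun Q =>
        Disjoint Q A ∧ ¬ Tileable G (A ∪ Q) with hO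
    have hFA : ((F ∪ A).card : ℝ) ≤ F.card + m * k := by
      have h1 : (F ∪ A).card ≤ F.card + A.card := Finset.card_union_le _ _
      have h2 : j * k ≤ m * k := Nat.mul_le_mul_right _ (by omega)
      have h3 : (F ∪ A).card ≤ F.card + m * k := by omega
      exact_mod_cast h3
    have hrich : ∀ Q ∈ O, Rich (δ * Fintype.card V) k fun l =>
        Absorbs G Q l ∧ l.Nodup ∧ ∀ v ∈ l, v ∉ F ∪ A := by
      intro Q hQ
      refine ((habs Q (Finset.mem_powersetCard.1 (Finset.mem_filter.1 hQ).1).2).avoid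
        (F ∪ A)).mono ?_ fun _ _ h => h
      linarith
    obtain ⟨l, hlk, hl⟩ := Rich.select hδ hn hrich
    set O' := O.filter fun Q => Absorbs G Q l ∧ l.Nodup ∧ ∀ v ∈ l, v ∉ F ∪ A with hO'
    have hl' : δ ^ k * O.card ≤ (O'.card : ℝ) := by convert hl
    have hpow : 0 ≤ 1 - δ ^ k := sub_nonneg.2 (pow_le_one₀ hδ hδ1)
    have hbound : (1 - δ ^ k) * O.card ≤ (1 - δ ^ k) ^ (j + 1) * (Fintype.card V : ℝ) ^ s := by
      rw [pow_succ', mul_assoc]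
      exact mul_le_mul_of_nonneg_left hA hpow
    -- A member of `O'` certifies that `l` is tileable and avoids `F ∪ A`. If there is none, `δ ^ k
    -- * O.card ≤ 0` and `A` can be kept as it is.
    rcases O'.eq_empty_or_nonempty with hemp | ⟨Q₀, hQ₀⟩
    · refine ⟨A, hAF, hAc.trans (Nat.mul_le_mul_right _ (by omega)), hAt, le_trans ?_ hbound⟩
      rw [hemp, Finset.card_empty, Nat.cast_zero] at hl'
      linarith
    obtain ⟨⟨hlt, hlQ₀, hlQ₀'⟩, hnd, hlF⟩ := (Finset.mem_filter.1 hQ₀).2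
    have hlFA : Disjoint l.toFinset (F ∪ A) :=
      Finset.disjoint_left.2 fun v hv => hlF v (List.mem_toFinset.1 hv)
    rw [Finset.disjoint_union_right] at hlFA
    refine ⟨A ∪ l.toFinset, Finset.disjoint_union_left.2 ⟨hAF, hlFA.1⟩, ?_,
      hAt.disjUnion hlt hlFA.2.symm, ?_⟩
    · refine (Finset.card_union_le _ _).trans ?_
      have := l.toFinset_card_le
      rw [Nat.succ_mul]
      omega
    · refine le_trans ?_ hbound
      have hsub : ((Finset.powersetCard s Finset.univ).filter fun Q =>
          Disjoint Q (A ∪ l.toFinset) ∧ ¬ Tileable G (A ∪ l.toFinset ∪ Q)) ⊆ O \ O' := by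
        intro Q hQ
        obtain ⟨hQs, hQd, hQt⟩ := Finset.mem_filter.1 hQ
        rw [Finset.disjoint_union_right] at hQd
        rw [Finset.mem_sdiff]
        refine ⟨Finset.mem_filter.2 ⟨hQs, hQd.1, fun h => hQt ?_⟩, fun h => hQt ?_⟩
        · rw [Finset.union_right_comm]
          exact h.disjUnion hlt (Finset.disjoint_union_left.2 ⟨hlFA.2.symm, hQd.2⟩)
        · rw [Finset.union_assoc]
          exact hAt.disjUnion (Finset.mem_filter.1 h).2.1.2.2
            (Finset.disjoint_union_right.2 ⟨hlFA.2.symm, hQd.1.symm⟩)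
      have h1 := Finset.card_le_card hsub
      have h2 := Finset.card_sdiff_add_card_eq_card (s := O') (t := O) (Finset.filter_subset _ _)
      have h3 : ((O \ O').card : ℝ) + O'.card = O.card := by exact_mod_cast h2
      refine (Nat.cast_le.2 h1).trans ?_
      linarith

/-- A small tileable set that can absorb any single `s`-set. -/
theorem exists_absorber {δ : ℝ} (hδ : 0 ≤ δ) (hδ1 : δ ≤ 1) {s k m : ℕ} (hn : 0 < Fintype.card V)
    (habs : ∀ Q : Finset V, Q.card = s → Rich (2 * δ * Fintype.card V) k (Absorbs G Q))
    (hm : (1 - δ ^ k) ^ m * (Fintype.card V : ℝ) ^ s < 1)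
    (F : Finset V) (hF : (F.card + (m + 1) * k : ℝ) ≤ δ * Fintype.card V) :
    ∃ A : Finset V, Disjoint A F ∧ A.card ≤ m * k ∧ Tileable G A ∧
      ∀ Q : Finset V, Q.card = s → Disjoint Q A → Tileable G (A ∪ Q) := by
  classical
  obtain ⟨A, h1, h2, h3, h4⟩ := exists_partial_absorber hδ hδ1 hn habs F hF m le_rfl
  refine ⟨A, h1, h2, h3, fun Q hQ hQA => ?_⟩
  by_contra hcon
  have h5 := h4.trans_lt hm
  have h6 : ((Finset.powersetCard s Finset.univ).filter fun Q =>
        Disjoint Q A ∧ ¬ Tileable G (A ∪ Q)).card = 0 := by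
    have : ((Finset.powersetCard s Finset.univ).filter fun Q =>
        Disjoint Q A ∧ ¬ Tileable G (A ∪ Q)).card < 1 := by exact_mod_cast h5
    omega
  have h7 := Finset.card_eq_zero.1 h6
  have : Q ∈ (Finset.powersetCard s Finset.univ).filter fun Q =>
        Disjoint Q A ∧ ¬ Tileable G (A ∪ Q) :=
    Finset.mem_filter.2 ⟨Finset.mem_powersetCard.2 ⟨Finset.subset_univ _, hQ⟩, hQA, hcon⟩
  rw [h7] at this
  simp at this

/-- A small tileable set that can absorb any set of at most `j * s` vertices whose size is divisible
by `s`. -/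
theorem exists_multi_absorber {δ : ℝ} (hδ : 0 ≤ δ) (hδ1 : δ ≤ 1) {s k m : ℕ}
    (hn : 0 < Fintype.card V)
    (habs : ∀ Q : Finset V, Q.card = s → Rich (2 * δ * Fintype.card V) k (Absorbs G Q))
    (hm : (1 - δ ^ k) ^ m * (Fintype.card V : ℝ) ^ s < 1) (j : ℕ)
    (hj : (j * (m * k) + (m + 1) * k : ℝ) ≤ δ * Fintype.card V) :
    ∃ A : Finset V, A.card ≤ j * (m * k) ∧ Tileable G A ∧
      ∀ i ≤ j, ∀ W : Finset V, W.card = i * s → Disjoint W A → Tileable G (A ∪ W) := by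
  induction j with
  | zero =>
    refine ⟨∅, by simp, .empty, fun i hi W hW _ => ?_⟩
    have : W = ∅ := by
      rw [← Finset.card_eq_zero, hW]
      simp [Nat.le_zero.1 hi]
    subst this
    simpa using Tileable.empty
  | succ j ih =>
    push_cast at hj
    have hmk : (0 : ℝ) ≤ m * k := by positivity
    obtain ⟨A, hAc, hAt, hA⟩ := ih (by linarith)
    obtain ⟨B, hBA, hBc, hBt, hB⟩ := exists_absorber hδ hδ1 hn habs hm A (by
      have : (A.card : ℝ) ≤ j * (m * k) := by exact_mod_cast hAc
      linarith)
    refine ⟨A ∪ B, ?_, hAt.disjUnion hBt hBA.symm, fun i hi W hW hWd => ?_⟩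
    · refine (Finset.card_union_le _ _).trans ?_
      rw [Nat.succ_mul]
      omega
    · rw [Finset.disjoint_union_right] at hWd
      rcases i with _ | i
      · have : W = ∅ := by rw [← Finset.card_eq_zero, hW, zero_mul]
        subst this
        simpa using hAt.disjUnion hBt hBA.symm
      · rw [Nat.succ_mul] at hW
        obtain ⟨Q, hQW, hQ⟩ := Finset.exists_subset_card_eq (s := W) (n := s) (by omega)
        have hQc := Finset.card_sdiff_add_card_eq_card hQW
        have heq : A ∪ B ∪ W = (A ∪ W \ Q) ∪ (B ∪ Q) := by
          conv_lhs => rw [← Finset.sdiff_union_of_subset hQW]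
          ext v
          simp only [Finset.mem_union]
          tauto
        rw [heq]
        refine (hA i (by omega) (W \ Q) (by omega) (hWd.1.mono_left Finset.sdiff_subset)).disjUnion
          (hB Q hQ (hWd.2.mono_left hQW)) ?_
        rw [Finset.disjoint_union_left, Finset.disjoint_union_right, Finset.disjoint_union_right]
        exact ⟨⟨hBA.symm, (hWd.1.mono_left hQW).symm⟩,
          hWd.2.mono_left Finset.sdiff_subset, Finset.sdiff_disjoint⟩

end Absorbing

/-! ### Good cliques and chains of vertices with few backward edges. -/

section Chains

variable {V : Type*} [DecidableEq V] (N : StdMultigraph V)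

/-- `K` is an acyclic `s`-set with at most `s / 2` edges, or with one half more than that and no
isolated vertex. -/
def IsGood (s : ℕ) (K : Finset V) : Prop :=
  K.card = s ∧ N.IsForestOn K ∧
    (N.weight K ≤ s ∨ (N.weight K ≤ s + 1 ∧ ∀ v ∈ K, 1 ≤ N.degIn K v))

/-- The entries of the list are new vertices, each with at most `c` edges to `B` and the entries
before it. -/
def IsChain (c : ℕ) : Finset V → List V → Prop
  | _, [] => True
  | B, v :: l => v ∉ B ∧ N.degIn B v ≤ c ∧ IsChain c (insert v B) l

variable {N}

theorem IsChain.spec {c : ℕ} (hc : c ≤ 1) {B : Finset V} {l : List V} (h : N.IsChain c B l)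
    {K : Finset V} (hKB : K ⊆ B) (hK : N.IsForestOn K) :
    N.IsForestOn (K ∪ l.toFinset) ∧ N.weight (K ∪ l.toFinset) ≤ N.weight K + 2 * (c * l.length) ∧
      (K ∪ l.toFinset).card = K.card + l.length ∧ ∀ v ∈ l, v ∉ B := by
  induction l generalizing B K with
  | nil => simpa using hK
  | cons v l ih =>
    obtain ⟨hvB, hvc, hl⟩ := h
    have hvK : v ∉ K := fun h => hvB (hKB h)
    have hvc' := (degIn_mono (N := N) hKB v).trans hvc
    obtain ⟨h1, h2, h3, h4⟩ := ih hl (Finset.insert_subset_insert v hKB)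
      (hK.insert_of_le (hvc'.trans hc))
    have heq : K ∪ (v :: l).toFinset = insert v K ∪ l.toFinset := by
      rw [List.toFinset_cons, Finset.union_insert, Finset.insert_union]
    rw [heq]
    refine ⟨h1, h2.trans ?_, ?_, ?_⟩
    · rw [weight_insert hvK, List.length_cons, mul_add]
      omega
    · rw [h3, Finset.card_insert_of_notMem hvK, List.length_cons]
      omega
    · intro w hw
      rcases List.mem_cons.1 hw with rfl | hw
      · exact hvB
      · exact fun hwB => h4 w hw (Finset.mem_insert_of_mem hwB)

theorem IsGood.of_fit {s : ℕ} {K : Finset V} (h : N.IsFitOn s K) (hK : K.card = s) :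
    N.IsGood s K :=
  ⟨hK, h.2.1, Or.inl (by have := h.2.2; omega)⟩

theorem IsForestOn.weight_add_two_le {K : Finset V} (hK : N.IsForestOn K) (hne : K.Nonempty) :
    N.weight K + 2 ≤ 2 * K.card := by
  obtain ⟨x, hx⟩ := hne
  induction hn : K.card generalizing K x with
  | zero => simp [Finset.card_eq_zero.1 hn] at hx
  | succ n ih =>
    obtain ⟨v, hv, hv'⟩ := hK K subset_rfl ⟨x, hx⟩
    have hcard := Finset.card_erase_of_mem hv
    have hw := weight_erase (N := N) hv
    rcases (K.erase v).eq_empty_or_nonempty with h | ⟨y, hy⟩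
    · have hd := degIn_erase_self (N := N) (K := K) v
      rw [h] at hw hd
      have h1 : N.weight ∅ = 0 := rfl
      have h2 : N.degIn ∅ v = 0 := rfl
      omega
    · have := ih (hK.mono (Finset.erase_subset v K)) y hy (by omega)
      simp only [add_zero] at hv'
      omega

/-- A forest on `s + 1` vertices may have one surplus half edge, provided that the erased vertex
takes an edge with it. -/
theorem isGood_erase {s : ℕ} {F : Finset V} (hF : N.IsForestOn F) (hcard : F.card = s + 1)
    {x : V} (hx : x ∈ F) (hw : N.weight F ≤ s ∨ (N.weight F ≤ s + 1 ∧ 1 ≤ N.degIn F x)) :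
    N.IsGood s (F.erase x) := by
  refine ⟨by rw [Finset.card_erase_of_mem hx]; omega, hF.mono (Finset.erase_subset _ _), Or.inl ?_⟩
  have := weight_erase (N := N) hx
  omega

end Chains

/-! ### Vertices with few edges to a small set; gadgets for even `s` and for `s = 3`. -/

section ManyEdges

variable {V : Type*} [DecidableEq V] [Fintype V] {N : StdMultigraph V}

theorem mul_card_le_of_pointwise {a b c : ℕ} {f : V → ℕ} {p q : V → Prop}
    (h : ∀ z, a ≤ f z ∨ (p z ∧ a ≤ f z + b) ∨ (q z ∧ a ≤ f z + c)) :
    (a * Fintype.card V : ℝ) ≤ (∑ z, f z : ℕ) + b * ({z | p z}.ncard : ℝ) +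
      c * ({z | q z}.ncard : ℝ) := by
  classical
  have hcount (p : V → Prop) : {v | p v}.ncard = (Finset.univ.filter p).card := by
    rw [← Set.ncard_coe_finset]; simp
  have key : Fintype.card V * a ≤ ∑ z, (f z + b * (if p z then 1 else 0) +
      c * (if q z then 1 else 0)) := by
    rw [← smul_eq_mul, ← Finset.card_univ]
    refine Finset.card_nsmul_le_sum _ _ _ fun z _ => ?_
    rcases h z with h | ⟨h1, h2⟩ | ⟨h1, h2⟩
    · exact h.trans (by omega)
    · rw [if_pos h1]; omega
    · rw [if_pos h1]; omega
  rw [Finset.sum_add_distrib, Finset.sum_add_distrib, ← Finset.mul_sum, ← Finset.mul_sum,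
    ← Finset.card_filter, ← Finset.card_filter, ← hcount, ← hcount] at key
  rw [mul_comm]
  exact_mod_cast key

variable {s : ℕ} {ε : ℝ}

theorem sum_degIn_le (hdeg : ∀ v, (N.degIn Finset.univ v : ℝ) ≤ (2 / s - ε) * Fintype.card V)
    (B : Finset V) :
    ((∑ z, N.degIn B z : ℕ) : ℝ) ≤ B.card * ((2 / s - ε) * Fintype.card V) := by
  rw [sum_degIn_comm, ← nsmul_eq_mul]
  push_cast
  exact Finset.sum_le_card_nsmul _ _ _ fun b _ => hdeg b

theorem sum_mult_le (hdeg : ∀ v, (N.degIn Finset.univ v : ℝ) ≤ (2 / s - ε) * Fintype.card V)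
    (x : V) : ((∑ z, N.mult x z : ℕ) : ℝ) ≤ (2 / s - ε) * Fintype.card V :=
  hdeg x

/-- The average number of edges from a vertex to `B` is at most `1 - ε`. -/
theorem many_degIn_eq_zero (hs : 1 ≤ s) (hε : 0 < ε)
    (hdeg : ∀ v, (N.degIn Finset.univ v : ℝ) ≤ (2 / s - ε) * Fintype.card V)
    {B : Finset V} (h1 : 1 ≤ B.card) (h2 : 2 * B.card ≤ s) :
    Many (ε * Fintype.card V) fun z => N.degIn B z = 0 := by
  have h := mul_card_le_of_pointwise (a := 1) (b := 1) (c := 0) (f := N.degIn B)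
    (p := fun z => N.degIn B z = 0) (q := fun _ => False) (fun z => by
      by_cases h : N.degIn B z = 0
      · exact Or.inr (Or.inl ⟨h, by omega⟩)
      · exact Or.inl (by omega))
  have h3 := sum_degIn_le hdeg B
  have hs0 : (0 : ℝ) < s := by exact_mod_cast hs
  have h1' : (1 : ℝ) ≤ B.card := by exact_mod_cast h1
  have h2' : (2 * B.card : ℝ) ≤ s := by exact_mod_cast h2
  have hn0 : (0 : ℝ) ≤ Fintype.card V := Nat.cast_nonneg _
  have h4 : B.card * (2 / (s : ℝ)) ≤ 1 := by
    rw [← mul_div_assoc, div_le_one hs0]; linarith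
  unfold Many
  push_cast at h h3
  have h5 : B.card * ((2 / s - ε) * Fintype.card V) ≤ (1 - ε) * Fintype.card V := by
    rw [← mul_assoc]
    refine mul_le_mul_of_nonneg_right ?_ hn0
    nlinarith
  linarith

/-- The average number of edges from a vertex to `B` is at most `2 - ε`. -/
theorem many_degIn_le_one (hs : 1 ≤ s) (hε : 0 < ε)
    (hdeg : ∀ v, (N.degIn Finset.univ v : ℝ) ≤ (2 / s - ε) * Fintype.card V)
    {B : Finset V} (h1 : 1 ≤ B.card) (h2 : B.card ≤ s) :
    Many (ε / 2 * Fintype.card V) fun z => N.degIn B z ≤ 1 := by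
  have h := mul_card_le_of_pointwise (a := 2) (b := 2) (c := 0) (f := N.degIn B)
    (p := fun z => N.degIn B z ≤ 1) (q := fun _ => False) (fun z => by
      by_cases h : N.degIn B z ≤ 1
      · exact Or.inr (Or.inl ⟨h, by omega⟩)
      · exact Or.inl (by omega))
  have h3 := sum_degIn_le hdeg B
  have hs0 : (0 : ℝ) < s := by exact_mod_cast hs
  have h1' : (1 : ℝ) ≤ B.card := by exact_mod_cast h1
  have h2' : (B.card : ℝ) ≤ s := by exact_mod_cast h2
  have hn0 : (0 : ℝ) ≤ Fintype.card V := Nat.cast_nonneg _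
  have h4 : B.card * (2 / (s : ℝ)) ≤ 2 := by
    rw [← mul_div_assoc, div_le_iff₀ hs0]; linarith
  unfold Many
  push_cast at h h3
  have h5 : B.card * ((2 / s - ε) * Fintype.card V) ≤ (2 - ε) * Fintype.card V := by
    rw [← mul_assoc]
    refine mul_le_mul_of_nonneg_right ?_ hn0
    nlinarith
  linarith

theorem Many.avoid_of_card_le {c : ℝ} {p : V → Prop} (h : Many (2 * c) p) {B : Finset V}
    (hB : B.card ≤ c) : Many c fun v => p v ∧ v ∉ B :=
  (h.avoid B).mono (by linarith) fun _ hv => hv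

/-- The last vertex still sees a set of at most `s / 2` vertices, so `many_degIn_eq_zero` applies at
each step. -/
theorem rich_isChain_zero (hs : 1 ≤ s) (hε : 0 < ε)
    (hdeg : ∀ v, (N.degIn Finset.univ v : ℝ) ≤ (2 / s - ε) * Fintype.card V)
    (hn : (s + 2 : ℝ) ≤ ε / 8 * Fintype.card V) (k : ℕ) {B : Finset V} (h1 : 1 ≤ B.card)
    (h2 : 2 * (B.card + k) ≤ s + 2) : Rich (ε / 8 * Fintype.card V) k (N.IsChain 0 B) := by
  induction k generalizing B with
  | zero => trivial
  | succ k ih =>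
    have hn0 : (0 : ℝ) ≤ ε * Fintype.card V := by positivity
    have hB : (B.card : ℝ) ≤ s + 2 := by
      have : B.card ≤ s + 2 := by omega
      exact_mod_cast this
    have hm : Many (ε / 8 * Fintype.card V) fun z => N.degIn B z = 0 ∧ z ∉ B :=
      Many.avoid_of_card_le ((many_degIn_eq_zero hs hε hdeg h1 (by omega)).mono (by linarith)
        fun _ h => h) (by linarith)
    refine hm.mono le_rfl fun v hv => ?_
    refine (ih (B := insert v B) (by simp) ?_).mono le_rfl fun l _ hl => ⟨hv.2, hv.1.le, hl⟩
    rw [Finset.card_insert_of_notMem hv.2]; omega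

theorem rich_isChain_one (hs : 1 ≤ s) (hε : 0 < ε)
    (hdeg : ∀ v, (N.degIn Finset.univ v : ℝ) ≤ (2 / s - ε) * Fintype.card V)
    (hn : (s + 2 : ℝ) ≤ ε / 8 * Fintype.card V) (k : ℕ) {B : Finset V} (h1 : 1 ≤ B.card)
    (h2 : B.card + k ≤ s + 1) : Rich (ε / 8 * Fintype.card V) k (N.IsChain 1 B) := by
  induction k generalizing B with
  | zero => trivial
  | succ k ih =>
    have hn0 : (0 : ℝ) ≤ ε * Fintype.card V := by positivity
    have hB : (B.card : ℝ) ≤ s + 2 := by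
      have : B.card ≤ s + 2 := by omega
      exact_mod_cast this
    have hm : Many (ε / 8 * Fintype.card V) fun z => N.degIn B z ≤ 1 ∧ z ∉ B :=
      Many.avoid_of_card_le ((many_degIn_le_one hs hε hdeg h1 (by omega)).mono (by linarith)
        fun _ h => h) (by linarith)
    refine hm.mono le_rfl fun v hv => ?_
    refine (ih (B := insert v B) (by simp) ?_).mono le_rfl fun l _ hl => ⟨hv.2, hv.1, hl⟩
    rw [Finset.card_insert_of_notMem hv.2]; omega

theorem weight_singleton (x : V) : N.weight {x} = 0 := by simp [weight, degIn, N.loopless]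

theorem isForestOn_singleton (x : V) : N.IsForestOn {x} :=
  isForestOn_of_weight_eq_zero (weight_singleton x)

theorem weight_pair {x y : V} (h : x ≠ y) : N.weight {x, y} = 2 * N.mult x y := by
  rw [weight_insert (by simpa using h), weight_singleton]
  simp [degIn]

/-- Zero steps followed by single steps from a set containing `x`. -/
theorem rich_isChain_zero_one (hs : 1 ≤ s) (hε : 0 < ε)
    (hdeg : ∀ v, (N.degIn Finset.univ v : ℝ) ≤ (2 / s - ε) * Fintype.card V)
    (hn : (s + 2 : ℝ) ≤ ε / 8 * Fintype.card V) (k j : ℕ) {B : Finset V} (h1 : 1 ≤ B.card)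
    (h2 : 2 * (B.card + k) ≤ s + 2) (h3 : B.card + k + j ≤ s + 1) :
    Rich (ε / 8 * Fintype.card V) (j + k) fun l => ∀ x ∈ B,
      N.IsForestOn (insert x l.toFinset) ∧ N.weight (insert x l.toFinset) ≤ 2 * j ∧
        (insert x l.toFinset).card = k + j + 1 := by
  refine ((rich_isChain_zero hs hε hdeg hn k h1 h2).append
    (Q := fun l₁ l₂ => N.IsChain 1 (B ∪ l₁.toFinset) l₂) fun l hl hch => ?_).mono le_rfl ?_
  · have h4 : (B ∪ l.toFinset).card ≤ B.card + k :=
      (Finset.card_union_le _ _).trans (by have := l.toFinset_card_le; omega)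
    exact rich_isChain_one hs hε hdeg hn j
      (h1.trans (Finset.card_le_card Finset.subset_union_left)) (by omega)
  · rintro _ - ⟨l₁, l₂, rfl, hl₁, hl₂, hch₁, hch₂⟩ x hx
    obtain ⟨a1, a2, a3, -⟩ := hch₁.spec zero_le_one (Finset.singleton_subset_iff.2 hx)
      (isForestOn_singleton x)
    obtain ⟨b1, b2, b3, -⟩ := hch₂.spec le_rfl
      (Finset.union_subset_union_left (Finset.singleton_subset_iff.2 hx)) a1
    have heq : insert x (l₁ ++ l₂).toFinset = {x} ∪ l₁.toFinset ∪ l₂.toFinset := by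
      rw [List.toFinset_append, Finset.union_assoc, Finset.insert_eq]
    rw [heq]
    refine ⟨b1, ?_, ?_⟩
    · rw [weight_singleton] at a2
      omega
    · rw [b3, a3, Finset.card_singleton]
      omega

theorem rich_isGood (hs : 1 ≤ s) (hε : 0 < ε) (hε1 : ε ≤ 8)
    (hdeg : ∀ v, (N.degIn Finset.univ v : ℝ) ≤ (2 / s - ε) * Fintype.card V)
    (hn : (s + 2 : ℝ) ≤ ε / 8 * Fintype.card V) :
    Rich (ε / 8 * Fintype.card V) s fun l => N.IsGood s l.toFinset := by
  obtain ⟨s, rfl⟩ : ∃ s', s = s' + 1 := ⟨s - 1, by omega⟩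
  have hall : Many (ε / 8 * Fintype.card V) fun _ : V => True := by
    unfold Many
    have : ({_v | True} : Set V).ncard = Fintype.card V := by
      rw [← Nat.card_eq_fintype_card, ← Set.ncard_univ]; rfl
    rw [this]
    have : (0 : ℝ) ≤ Fintype.card V := Nat.cast_nonneg _
    nlinarith
  refine hall.mono le_rfl fun x _ => ?_
  have h := rich_isChain_zero_one hs hε hdeg hn ((s + 1) / 2) (s - (s + 1) / 2)
    (B := {x}) (by simp) (by simp; omega) (by simp; omega)
  rw [show s - (s + 1) / 2 + (s + 1) / 2 = s by omega] at h
  refine h.mono le_rfl fun l _ hl => ?_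
  obtain ⟨h1, h2, h3⟩ := hl x (by simp)
  rw [List.toFinset_cons]
  exact ⟨by omega, h1, Or.inl (by omega)⟩

/-- With `s = 2r`, adding `r - 1` vertices without backward edges and then `r` with at most one
gives at most `r = s / 2` edges, whichever of `x` and `y` is kept. -/
theorem rich_gadget_of_even (hs : 1 ≤ s) (hε : 0 < ε)
    (hdeg : ∀ v, (N.degIn Finset.univ v : ℝ) ≤ (2 / s - ε) * Fintype.card V)
    (hn : (s + 2 : ℝ) ≤ ε / 8 * Fintype.card V) (heven : Even s) {x y : V} (hxy : x ≠ y) :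
    Rich (ε / 8 * Fintype.card V) (s - 1) (Gadget (N.IsGood s) x y) := by
  obtain ⟨r, rfl⟩ := heven
  have hcard : ({x, y} : Finset V).card = 2 := Finset.card_pair hxy
  have h := rich_isChain_zero_one hs hε hdeg hn (r - 1) r (B := {x, y}) (by omega) (by omega)
    (by omega)
  rw [show r + (r - 1) = r + r - 1 by omega] at h
  refine h.mono le_rfl fun l _ hl => ?_
  have hgood : ∀ z ∈ ({x, y} : Finset V), N.IsGood (r + r) (insert z l.toFinset) := fun z hz => by
    obtain ⟨h1, h2, h3⟩ := hl z hz
    exact ⟨by omega, h1, Or.inl (by omega)⟩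
  exact ⟨.of_mem (hgood x (by simp)), .of_mem (hgood y (by simp))⟩

theorem rich_gadget_of_eq_three (hε : 0 < ε)
    (hdeg : ∀ v, (N.degIn Finset.univ v : ℝ) ≤ (2 / (3 : ℕ) - ε) * Fintype.card V)
    (hn : ((3 : ℕ) + 2 : ℝ) ≤ ε / 8 * Fintype.card V) {x y : V} (hxy : x ≠ y) :
    Rich (ε / 8 * Fintype.card V) 2 (Gadget (N.IsGood 3) x y) := by
  have hcard : ({x, y} : Finset V).card = 2 := Finset.card_pair hxy
  have h := rich_isChain_zero_one (by norm_num) hε hdeg hn 0 2 (B := {x, y}) (by omega) (by omega)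
    (by omega)
  refine h.mono le_rfl fun l _ hl => ?_
  have hgood : ∀ z ∈ ({x, y} : Finset V), N.IsGood 3 (insert z l.toFinset) := fun z hz => by
    obtain ⟨h1, h2, h3⟩ := hl z hz
    refine ⟨by omega, h1, ?_⟩
    by_cases hw : N.weight (insert z l.toFinset) ≤ 3
    · exact Or.inl hw
    -- Two edges on three vertices leave no vertex isolated, since the other two carry at most one
    -- edge.
    · refine Or.inr ⟨by omega, fun v hv => ?_⟩
      by_contra hd
      have hw' := weight_erase (N := N) hv
      have hc := Finset.card_erase_of_mem hv
      have := IsForestOn.weight_add_two_le (N := N) (h1.mono (Finset.erase_subset v _))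
        (Finset.card_pos.1 (by omega))
      omega
  exact ⟨.of_mem (hgood x (by simp)), .of_mem (hgood y (by simp))⟩

end ManyEdges

/-! ### Private neighbours; gadgets for `s = 5`. -/

section OddReach

variable {V : Type*} [DecidableEq V] [Fintype V] {N : StdMultigraph V} {s : ℕ} {ε : ℝ}

theorem degIn_eq_add_erase {T : Finset V} {x : V} (hx : x ∈ T) (z : V) :
    N.degIn T z = N.mult x z + N.degIn (T.erase x) z := by
  conv_lhs => rw [← Finset.insert_erase hx, degIn_insert (by simp), N.symm]

/-- If few vertices send no edge to `T`, then many vertices send exactly one edge to `T`, namely to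
a prescribed vertex `x` of `T`. -/
theorem many_private (hs : 1 ≤ s) (hε : 0 < ε)
    (hdeg : ∀ v, (N.degIn Finset.univ v : ℝ) ≤ (2 / s - ε) * Fintype.card V)
    {T : Finset V} {x : V} (hx : x ∈ T) (hT : 2 * T.card = s + 1)
    (hzero : ¬ Many (ε / 4 * Fintype.card V) fun z => N.degIn T z = 0) :
    Many (ε / 4 * Fintype.card V) fun z => N.degIn T z = 1 ∧ N.mult x z = 1 := by
  -- Counting `x` once and the other vertices of `T` twice gives total multiplicity `s`, hence an
  -- average below `2`. A vertex with an edge to `T` falls short of `2` only if its single edge goes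
  -- to `x`.
  have h := mul_card_le_of_pointwise (a := 2) (b := 1) (c := 2)
    (f := fun z => 2 * N.degIn (T.erase x) z + N.mult x z)
    (p := fun z => N.degIn T z = 1 ∧ N.mult x z = 1) (q := fun z => N.degIn T z = 0) (fun z => by
      have := degIn_eq_add_erase (N := N) hx z
      omega)
  rw [Finset.sum_add_distrib, ← Finset.mul_sum] at h
  have h1 := sum_degIn_le hdeg (T.erase x)
  have h2 := sum_mult_le hdeg x
  rw [Finset.card_erase_of_mem hx] at h1
  have hTc : ((T.card - 1 : ℕ) : ℝ) = (s - 1) / 2 := by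
    have : 2 * (T.card - 1) + 1 = s := by omega
    have : (2 * ((T.card - 1 : ℕ) : ℝ) + 1) = s := by exact_mod_cast this
    linarith
  rw [hTc] at h1
  push_cast at h h1 h2
  unfold Many at hzero ⊢
  push Not at hzero
  set n : ℝ := ((Fintype.card V : ℕ) : ℝ)
  have hn0 : 0 ≤ n := Nat.cast_nonneg _
  have hs0 : (0 : ℝ) < s := by exact_mod_cast hs
  have hs1 : (1 : ℝ) ≤ s := by exact_mod_cast hs
  have h3 : (2 * ((s - 1) / 2) + 1) * ((2 / s - ε) * n) = 2 * n - s * (ε * n) := by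
    field_simp
    ring
  have h4 : ε * n ≤ s * (ε * n) := le_mul_of_one_le_left (by positivity) hs1
  nlinarith

theorem rich_gadget_of_eq_five (hε : 0 < ε)
    (hdeg : ∀ v, (N.degIn Finset.univ v : ℝ) ≤ (2 / (5 : ℕ) - ε) * Fintype.card V)
    (hn : ((5 : ℕ) + 2 : ℝ) ≤ ε / 8 * Fintype.card V) {x y : V} (hxy : x ≠ y) :
    Rich (ε / 8 * Fintype.card V) 4 (Gadget (N.IsGood 5) x y) := by
  have hn0 : (0 : ℝ) ≤ ε * Fintype.card V := by positivity
  have havoid : ∀ {p : V → Prop} {B : Finset V}, Many (ε / 4 * Fintype.card V) p → B.card ≤ 6 →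
      Many (ε / 8 * Fintype.card V) fun v => p v ∧ v ∉ B := by
    intro p B h hB
    refine Many.avoid_of_card_le (h.mono (by linarith) fun _ h => h) ?_
    have : (B.card : ℝ) ≤ 6 := by exact_mod_cast hB
    push_cast at hn
    linarith
  have hzero := havoid (B := {x, y}) ((many_degIn_eq_zero (by norm_num) hε hdeg (B := {x, y})
    (by rw [Finset.card_pair hxy]; norm_num) (by rw [Finset.card_pair hxy]; norm_num)).mono
      (by linarith) fun _ h => h) (by rw [Finset.card_pair hxy]; norm_num)
  refine hzero.mono le_rfl fun t ht => ?_
  obtain ⟨ht0, htB⟩ := ht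
  have hx1 := degIn_mono (N := N) (show {x} ⊆ ({x, y} : Finset V) by simp) t
  have hy1 := degIn_mono (N := N) (show {y} ⊆ ({x, y} : Finset V) by simp) t
  have hTcard : (insert t ({x, y} : Finset V)).card = 3 := by
    rw [Finset.card_insert_of_notMem htB, Finset.card_pair hxy]
  have hxT : x ∈ insert t ({x, y} : Finset V) := by simp
  have hsub : ∀ z ∈ ({x, y} : Finset V), insert t {z} ⊆ insert t ({x, y} : Finset V) := fun z hz =>
    Finset.insert_subset_insert _ (Finset.singleton_subset_iff.2 hz)
  have htz : ∀ z ∈ ({x, y} : Finset V), t ∉ ({z} : Finset V) := fun z hz h =>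
    htB (Finset.mem_singleton.1 h ▸ hz)
  have hwt : ∀ z ∈ ({x, y} : Finset V), N.weight (insert t {z}) = 0 := fun z hz => by
    have := degIn_mono (N := N) (Finset.singleton_subset_iff.2 hz) t
    rw [weight_insert (htz z hz), weight_singleton]
    omega
  have hct : ∀ z ∈ ({x, y} : Finset V), (insert t {z} : Finset V).card = 2 := fun z hz => by
    rw [Finset.card_insert_of_notMem (htz z hz), Finset.card_singleton]
  have hlist : ∀ z a b w : V, insert z [t, a, b, w].toFinset =
      insert w (insert b (insert a (insert t {z}))) := fun z a b w => by
    ext u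
    simp only [List.toFinset_cons, List.toFinset_nil, Finset.mem_insert, Finset.mem_singleton,
      Finset.notMem_empty, or_false]
    tauto
  by_cases hbig : Many (ε / 4 * Fintype.card V) fun z => N.degIn (insert t {x, y}) z = 0
  · refine (havoid (B := insert t {x, y}) hbig (by omega)).mono le_rfl fun a ha => ?_
    obtain ⟨ha0, haB⟩ := ha
    have hac : (insert a (insert t ({x, y} : Finset V))).card = 4 := by
      rw [Finset.card_insert_of_notMem haB, hTcard]
    have hch := rich_isChain_one (by norm_num) hε hdeg hn 2
      (B := insert a (insert t ({x, y} : Finset V))) (by omega) (by omega)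
    refine hch.mono le_rfl fun l hl hl1 => ?_
    have hgood : ∀ z ∈ ({x, y} : Finset V), N.IsGood 5 (insert z (t :: a :: l).toFinset) := by
      intro z hz
      have haz : a ∉ insert t ({z} : Finset V) := fun h => haB (hsub z hz h)
      have hd := degIn_mono (N := N) (hsub z hz) a
      have hw : N.weight (insert a (insert t {z})) = 0 := by
        rw [weight_insert haz, hwt z hz]
        omega
      obtain ⟨h1, h2, h3, -⟩ := hl1.spec le_rfl (Finset.insert_subset_insert a (hsub z hz))
        (isForestOn_of_weight_eq_zero hw)
      have heq : insert z (t :: a :: l).toFinset = insert a (insert t {z}) ∪ l.toFinset := by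
        ext u
        simp only [List.toFinset_cons, Finset.mem_union, Finset.mem_insert, Finset.mem_singleton]
        tauto
      rw [Finset.card_insert_of_notMem haz, hct z hz] at h3
      rw [heq]
      exact ⟨by omega, h1, Or.inl (by omega)⟩
    exact ⟨.of_mem (hgood x (by simp)), .of_mem (hgood y (by simp))⟩
  · refine (havoid (B := insert t {x, y}) (many_private (by norm_num) hε hdeg hxT
      (by rw [hTcard]) hbig) (by omega)).mono le_rfl fun a ha => ?_
    obtain ⟨⟨haT, hax⟩, haB⟩ := ha
    have hac : (insert a (insert t ({x, y} : Finset V))).card = 4 := by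
      rw [Finset.card_insert_of_notMem haB, hTcard]
    have hbmany : Many (ε / 4 * Fintype.card V) fun b =>
        N.degIn (insert a (insert t {x, y})) b ≤ 1 ∧ N.mult x b = 0 ∧
          1 ≤ N.degIn (insert t {x, y}) b := by
      -- With `x` counted twice the four vertices have total multiplicity five, so the average is
      -- below `2`. Such a `b` has exactly one edge to `{x, y, t, a}`, and it goes to `y` or `t`.
      have h := mul_card_le_of_pointwise (a := 2) (b := 1) (c := 2)
        (f := fun b => N.degIn (insert a (insert t {x, y})) b + N.mult x b)
        (p := fun b => N.degIn (insert a (insert t {x, y})) b ≤ 1 ∧ N.mult x b = 0 ∧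
          1 ≤ N.degIn (insert t {x, y}) b)
        (q := fun b => N.degIn (insert t {x, y}) b = 0) (fun b => by
          have := degIn_insert (N := N) haB b
          omega)
      rw [Finset.sum_add_distrib] at h
      have h1 := sum_degIn_le hdeg (insert a (insert t {x, y}))
      have h2 := sum_mult_le hdeg x
      rw [hac] at h1
      push_cast at h h1 h2
      unfold Many at hbig ⊢
      push Not at hbig
      linarith
    refine (havoid (B := insert a (insert t {x, y})) hbmany (by omega)).mono le_rfl fun b hb => ?_
    obtain ⟨⟨hb1, hbx, hbT⟩, hbB⟩ := hb
    have hbc : (insert b (insert a (insert t ({x, y} : Finset V)))).card = 5 := by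
      rw [Finset.card_insert_of_notMem hbB, hac]
    refine (havoid (B := insert b (insert a (insert t {x, y}))) ((many_degIn_le_one (by norm_num)
      hε hdeg (B := insert b (insert a (insert t {x, y}))) (by omega) (by omega)).mono
        (by linarith) fun _ h => h) (by omega)).mono le_rfl fun w hw => ?_
    obtain ⟨hw1, hwB⟩ := hw
    have hdegs := degIn_insert (N := N) haB b
    have hstruct : ∀ z ∈ ({x, y} : Finset V),
        N.IsForestOn (insert w (insert b (insert a (insert t {z})))) ∧
        (insert w (insert b (insert a (insert t ({z} : Finset V))))).card = 5 ∧
        N.weight (insert w (insert b (insert a (insert t {z})))) =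
          2 * N.degIn (insert t {z}) a + 2 * N.degIn (insert a (insert t {z})) b +
            2 * N.degIn (insert b (insert a (insert t {z}))) w ∧
        N.degIn (insert t {z}) a ≤ 1 ∧ N.degIn (insert a (insert t {z})) b ≤ 1 ∧
        N.degIn (insert b (insert a (insert t {z}))) w ≤ 1 := by
      intro z hz
      have hsa := Finset.insert_subset_insert a (hsub z hz)
      have hsb := Finset.insert_subset_insert b hsa
      have d1 := (degIn_mono (N := N) (hsub z hz) a).trans haT.le
      have d2 := (degIn_mono (N := N) hsa b).trans hb1
      have d3 := (degIn_mono (N := N) hsb w).trans hw1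
      have n1 : a ∉ insert t ({z} : Finset V) := fun h => haB (hsub z hz h)
      have n2 : b ∉ insert a (insert t ({z} : Finset V)) := fun h => hbB (hsa h)
      have n3 : w ∉ insert b (insert a (insert t ({z} : Finset V))) := fun h => hwB (hsb h)
      refine ⟨(((isForestOn_of_weight_eq_zero (hwt z hz)).insert_of_le d1).insert_of_le
        d2).insert_of_le d3, ?_, ?_, d1, d2, d3⟩
      · rw [Finset.card_insert_of_notMem n3, Finset.card_insert_of_notMem n2,
          Finset.card_insert_of_notMem n1, hct z hz]
      · rw [weight_insert n3, weight_insert n2, weight_insert n1, hwt z hz]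
        omega
    have hTx := degIn_eq_add_erase (N := N) hxT a
    have hty : insert t {y} ⊆ (insert t ({x, y} : Finset V)).erase x := by
      intro u hu
      rw [Finset.mem_erase]
      refine ⟨?_, hsub y (by simp) hu⟩
      rintro rfl
      rcases Finset.mem_insert.1 hu with h | h
      · subst h; simp at htB
      · exact hxy (Finset.mem_singleton.1 h)
    have hya := degIn_mono (N := N) hty a
    show Tileable _ (insert x [t, a, b, w].toFinset) ∧ Tileable _ (insert y [t, a, b, w].toFinset)
    rw [hlist, hlist]
    refine ⟨.of_mem ?_, .of_mem ?_⟩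
    · obtain ⟨h1, h2, h3, d1, d2, d3⟩ := hstruct x (by simp)
      refine ⟨h2, h1, ?_⟩
      -- If neither vanishes, the edges are `xa`, `tb` and one at `w`, so no vertex is isolated and
      -- the near matching clause applies.
      by_cases hcase : N.degIn (insert a (insert t {x})) b = 0 ∨
          N.degIn (insert b (insert a (insert t {x}))) w = 0
      · exact Or.inl (by omega)
      · push Not at hcase
        refine Or.inr ⟨by omega, ?_⟩
        have hba : N.mult b a = 0 := by omega
        have hbt : 1 ≤ N.mult b t := by
          have e1 := degIn_insert (N := N) (K := insert t {x}) (z := a)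
            (fun h => haB (hsub x (by simp) h)) b
          have e2 := degIn_insert (N := N) (htz x (by simp)) b
          have e3 : N.degIn {x} b = N.mult x b := by simp [degIn, N.symm]
          omega
        have hxa' : N.mult a x = 1 := by rw [N.symm]; exact hax
        have htb' : 1 ≤ N.mult t b := by rw [N.symm]; exact hbt
        intro v hv
        simp only [Finset.mem_insert, Finset.mem_singleton] at hv
        have hle : ∀ u ∈ insert w (insert b (insert a (insert t {x}))), 1 ≤ N.mult v u →
            1 ≤ N.degIn (insert w (insert b (insert a (insert t {x})))) v := fun u hu h =>
          h.trans (mult_le_degIn hu v)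
        rcases hv with rfl | rfl | rfl | rfl | rfl
        · have := degIn_mono (N := N) (Finset.subset_insert v (insert b (insert a (insert t {x})))) v
          omega
        · exact hle t (by simp) hbt
        · exact hle x (by simp) hxa'.ge
        · exact hle b (by simp) htb'
        · exact hle a (by simp) hax.ge
    -- The only edge from `a` to `T` goes to `x`; with `y` in place of `x` at most two edges remain.
    · obtain ⟨h1, h2, h3, d1, d2, d3⟩ := hstruct y (by simp)
      exact ⟨h2, h1, Or.inl (by omega)⟩

end OddReach

/-! ### Gadgets for odd `s` at least seven. -/

section OddReachLarge

variable {V : Type*} [DecidableEq V] [Fintype V] {N : StdMultigraph V} {s : ℕ} {ε : ℝ}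

theorem Rich.exists {c : ℝ} (hc : 0 < c) {k : ℕ} {P : List V → Prop} (h : Rich c k P) :
    ∃ l, P l := by
  induction k generalizing P with
  | zero => exact ⟨[], h⟩
  | succ k ih =>
    obtain ⟨v, hv⟩ := Many.exists h hc
    obtain ⟨l, hl⟩ := ih hv
    exact ⟨v :: l, hl⟩

theorem Many.diff {c c' : ℝ} {p q : V → Prop} (h : Many c p) (hq : ¬ Many c' q) :
    Many (c - c') fun v => p v ∧ ¬ q v := by
  unfold Many at *
  push Not at hq
  have h1 : {v | p v} ⊆ {v | p v ∧ ¬ q v} ∪ {v | q v} := fun v hv => by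
    by_cases hF : q v
    · exact Or.inr hF
    · exact Or.inl ⟨hv, hF⟩
  have h2 : {v | p v}.ncard ≤ {v | p v ∧ ¬ q v}.ncard + {v | q v}.ncard :=
    (Set.ncard_le_ncard h1 (Set.toFinite _)).trans (Set.ncard_union_le _ _)
  have h3 : ({v | p v}.ncard : ℝ) ≤ {v | p v ∧ ¬ q v}.ncard + {v | q v}.ncard := by
    exact_mod_cast h2
  linarith

/-- Reduces a gadget to one set of `s + 1` vertices from which either `x` or `y` may be deleted. -/
theorem gadget_of_erase {F : Finset V} {x y : V} {l : List V} (hxy : x ≠ y)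
    (hF : F = insert x (insert y l.toFinset)) (hxl : x ∉ l) (hyl : y ∉ l)
    (hx : N.IsGood s (F.erase x)) (hy : N.IsGood s (F.erase y)) : Gadget (N.IsGood s) x y l := by
  have h1 : F.erase x = insert y l.toFinset := by
    rw [hF, Finset.erase_insert (by simp [hxy, hxl])]
  have h2 : F.erase y = insert x l.toFinset := by
    rw [hF, Finset.insert_comm, Finset.erase_insert (by simp [hxy.symm, hyl])]
  rw [h1] at hx
  rw [h2] at hy
  exact ⟨.of_mem hy, .of_mem hx⟩

/-- One more vertex without edges makes `p + 1` independent vertices. The remaining `p - 1` bring at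
most `p - 1` edges, few enough even before a deletion. -/
theorem rich_gadget_of_big_zero {p : ℕ} (hp : 4 ≤ p) (hs : s + 1 = 2 * p) (hε : 0 < ε)
    (hdeg : ∀ v, (N.degIn Finset.univ v : ℝ) ≤ (2 / s - ε) * Fintype.card V)
    (hn : (s + 2 : ℝ) ≤ ε / 8 * Fintype.card V) {x t : V} (hxt : t ≠ x) (hm : N.mult x t = 0)
    (h : Rich (ε / 16 * Fintype.card V) (p - 2) fun l => N.IsChain 0 {x, t} l ∧
      Many (ε / 4 * Fintype.card V) fun z => N.degIn ({x, t} ∪ l.toFinset) z = 0) :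
    Rich (ε / 16 * Fintype.card V) (s - 1) (Gadget (N.IsGood s) x t) := by
  have hn0 : (0 : ℝ) ≤ ε * Fintype.card V := by positivity
  have hw : N.weight {x, t} = 0 := by rw [weight_pair hxt.symm, hm]
  have hxtc : ({x, t} : Finset V).card = 2 := Finset.card_pair hxt.symm
  have hspec : ∀ {l : List V}, l.length = p - 2 → N.IsChain 0 {x, t} l →
      N.weight ({x, t} ∪ l.toFinset) = 0 ∧ ({x, t} ∪ l.toFinset).card = p ∧
        ∀ v ∈ l, v ∉ ({x, t} : Finset V) := by
    intro l hl hch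
    obtain ⟨-, h2, h3, h4⟩ := hch.spec zero_le_one subset_rfl (isForestOn_of_weight_eq_zero hw)
    exact ⟨by omega, by omega, h4⟩
  have happ := h.append (m := (p - 1) + 1) (Q := fun l l' => ∃ z l₁, l' = z :: l₁ ∧
    N.degIn ({x, t} ∪ l.toFinset) z = 0 ∧ z ∉ {x, t} ∪ l.toFinset ∧ l₁.length = p - 1 ∧
      N.IsChain 1 (insert z ({x, t} ∪ l.toFinset)) l₁) (fun l hl hP => by
    obtain ⟨-, hc, -⟩ := hspec hl hP.1
    have hmany : Many (ε / 8 * Fintype.card V) fun z =>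
        N.degIn ({x, t} ∪ l.toFinset) z = 0 ∧ z ∉ {x, t} ∪ l.toFinset := by
      refine Many.avoid_of_card_le (hP.2.mono (by linarith) fun _ h => h) ?_
      have : ({x, t} ∪ l.toFinset).card ≤ s + 2 := by omega
      have : (({x, t} ∪ l.toFinset).card : ℝ) ≤ s + 2 := by exact_mod_cast this
      linarith
    refine hmany.mono (by linarith) fun z hz => ?_
    refine (rich_isChain_one (by omega) hε hdeg hn (p - 1)
      (B := insert z ({x, t} ∪ l.toFinset)) (by simp) ?_).mono (by linarith)
        fun l₁ hl₁ hch => ⟨z, l₁, rfl, hz.1, hz.2, hl₁, hch⟩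
    rw [Finset.card_insert_of_notMem hz.2]
    omega)
  rw [show p - 1 + 1 + (p - 2) = s - 1 by omega] at happ
  refine happ.mono le_rfl ?_
  rintro _ - ⟨l, _, rfl, hl, -, ⟨hch, -⟩, z, l₁, rfl, hz0, hzT, hl₁, hch₁⟩
  obtain ⟨hw0, hc0, hl0⟩ := hspec hl hch
  have hwz : N.weight (insert z ({x, t} ∪ l.toFinset)) = 0 := by rw [weight_insert hzT]; omega
  obtain ⟨h1, h2, h3, h4⟩ := hch₁.spec le_rfl subset_rfl (isForestOn_of_weight_eq_zero hwz)
  rw [Finset.card_insert_of_notMem hzT] at h3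
  have hnot : ∀ u ∈ ({x, t} : Finset V), u ∉ l ++ z :: l₁ := by
    intro u hu hul
    rcases List.mem_append.1 hul with h | h
    · exact hl0 u h hu
    · rcases List.mem_cons.1 h with rfl | h
      · exact hzT (Finset.mem_union_left _ hu)
      · exact h4 u h (Finset.mem_insert_of_mem (Finset.mem_union_left _ hu))
  refine gadget_of_erase (F := insert z ({x, t} ∪ l.toFinset) ∪ l₁.toFinset) hxt.symm ?_
    (hnot x (by simp)) (hnot t (by simp))
    (isGood_erase h1 (by omega) (by simp) (Or.inl (by omega)))
    (isGood_erase h1 (by omega) (by simp) (Or.inl (by omega)))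
  ext u
  simp only [List.toFinset_append, List.toFinset_cons, Finset.mem_union, Finset.mem_insert,
    Finset.mem_singleton, List.mem_toFinset]
  tauto

/-- The vertices `b` reached from a set that already carries an edge at `x`. -/
theorem rich_gadget_of_rich_attached {p : ℕ} (hp : 4 ≤ p) (hs : s + 1 = 2 * p) (hε : 0 < ε)
    (hdeg : ∀ v, (N.degIn Finset.univ v : ℝ) ≤ (2 / s - ε) * Fintype.card V)
    (hn : (s + 2 : ℝ) ≤ ε / 8 * Fintype.card V) {c : ℝ} (hc : c ≤ ε / 8 * Fintype.card V) {x b : V}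
    (h : Rich c p fun l => x ∉ l ∧ N.IsForestOn (insert x l.toFinset) ∧
      (insert x l.toFinset).card = p + 1 ∧ N.weight (insert x l.toFinset) ≤ 2 ∧
      1 ≤ N.degIn (insert x l.toFinset) x ∧ b ∉ insert x l.toFinset ∧
      N.degIn (insert x l.toFinset) b ≤ 1) :
    Rich c (s - 1) (Gadget (N.IsGood s) x b) := by
  have happ := h.append (m := p - 2) (Q := fun l l' =>
    N.IsChain 1 (insert b (insert x l.toFinset)) l') (fun l hl hP => by
    obtain ⟨-, -, h2, -, -, h5, -⟩ := hP
    refine (rich_isChain_one (by omega) hε hdeg hn (p - 2)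
      (B := insert b (insert x l.toFinset)) (by simp) ?_).mono hc fun _ _ h => h
    rw [Finset.card_insert_of_notMem h5]
    omega)
  rw [show p - 2 + p = s - 1 by omega] at happ
  refine happ.mono le_rfl ?_
  rintro _ - ⟨l, l', rfl, hl, hl', ⟨hxl, h1, h2, h3, h4, h5, h6⟩, hch⟩
  obtain ⟨a1, a2, a3, a4⟩ := hch.spec le_rfl subset_rfl (h1.insert_of_le h6)
  rw [weight_insert h5] at a2
  rw [Finset.card_insert_of_notMem h5] at a3
  have hsub : insert x l.toFinset ⊆ insert b (insert x l.toFinset) ∪ l'.toFinset :=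
    (Finset.subset_insert _ _).trans Finset.subset_union_left
  have hdx := degIn_mono (N := N) hsub x
  have hdb := degIn_mono (N := N) hsub b
  have hxb : x ≠ b := by rintro rfl; simp at h5
  -- The forest has at most `p` edges, one too many. Deleting `x` loses its edge; deleting `b` loses
  -- one too, unless `b` brought none to the initial set, in which case there are at most `p - 1`
  -- edges anyway.
  refine gadget_of_erase (F := insert b (insert x l.toFinset) ∪ l'.toFinset) hxb ?_ ?_ ?_
    (isGood_erase a1 (by omega) (by simp) (by omega))
    (isGood_erase a1 (by omega) (by simp) (by omega))
  · ext u
    simp only [List.toFinset_append, Finset.mem_union, Finset.mem_insert, List.mem_toFinset]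
    tauto
  · rw [List.mem_append, not_or]
    exact ⟨hxl, fun h => a4 x h (by simp)⟩
  · rw [List.mem_append, not_or]
    exact ⟨fun h => h5 (by simp [h]), fun h => a4 b h (by simp)⟩

theorem many_reach_of_odd {p : ℕ} (hp : 4 ≤ p) (hs : s + 1 = 2 * p) (hε : 0 < ε) (hε1 : ε ≤ 1)
    (hdeg : ∀ v, (N.degIn Finset.univ v : ℝ) ≤ (2 / s - ε) * Fintype.card V)
    (hn : (s + 2 : ℝ) ≤ ε / 8 * Fintype.card V) (x : V) :
    Many (15 / 28 * Fintype.card V) fun w =>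
      Rich (ε / 16 * (ε / 16 / 2) ^ p * Fintype.card V) (s - 1) (Gadget (N.IsGood s) x w) := by
  set C : V → Prop := fun w =>
      Rich (ε / 16 * (ε / 16 / 2) ^ p * Fintype.card V) (s - 1) (Gadget (N.IsGood s) x w) with hC
  by_contra hnot
  have hV : 0 < Fintype.card V := Fintype.card_pos_iff.2 ⟨x⟩
  have hV' : (0 : ℝ) < Fintype.card V := by exact_mod_cast hV
  have hn0 : (0 : ℝ) ≤ ε * Fintype.card V := by positivity
  have hs7 : (7 : ℝ) ≤ s := by
    have : 7 ≤ s := by omega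
    exact_mod_cast this
  have hs0 : (0 : ℝ) < s := by linarith
  have h2s : 2 / (s : ℝ) ≤ 2 / 7 := div_le_div_of_nonneg_left (by norm_num) (by norm_num) hs7
  have hle : ε / 16 * (ε / 16 / 2) ^ p * Fintype.card V ≤ ε / 16 * Fintype.card V := by
    refine mul_le_mul_of_nonneg_right (mul_le_of_le_one_right (by positivity) ?_) hV'.le
    exact pow_le_one₀ (by positivity) (by linarith)
  have hpos : 0 < ε / 16 * (ε / 16 / 2) ^ p * Fintype.card V := by positivity
  have havoid : ∀ {q : V → Prop} {B : Finset V}, Many (ε / 4 * Fintype.card V) q →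
      B.card ≤ s + 2 → Many (ε / 8 * Fintype.card V) fun v => q v ∧ v ∉ B := by
    intro q B h hB
    refine Many.avoid_of_card_le (h.mono (by linarith) fun _ h => h) ?_
    have : (B.card : ℝ) ≤ s + 2 := by exact_mod_cast hB
    linarith
  -- At least `5 / 7` of the vertices send no edge to `x`, and by assumption fewer than `15 / 28`
  -- are reachable.
  have hfar : Many (ε / 4 * Fintype.card V) fun t => N.mult x t = 0 ∧ ¬ C t := by
    have h := mul_card_le_of_pointwise (a := 1) (b := 1) (c := 0) (f := N.mult x)
      (p := fun z => N.mult x z = 0) (q := fun _ => False) (fun z => by omega)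
    have h2 := sum_mult_le hdeg x
    push_cast at h h2
    have h3 : Many ((1 - 2 / 7 + ε) * Fintype.card V) fun z => N.mult x z = 0 := by
      unfold Many
      have : (2 / s - ε) * Fintype.card V ≤ (2 / 7 - ε) * Fintype.card V :=
        mul_le_mul_of_nonneg_right (by linarith) hV'.le
      linarith
    exact (h3.diff hnot).mono (by linarith) fun _ h => h
  have hfar' := havoid (B := {x}) hfar (by simp)
  set core : List V → Prop := fun l => x ∉ l ∧ N.IsForestOn (insert x l.toFinset) ∧
      (insert x l.toFinset).card = p + 1 ∧ N.weight (insert x l.toFinset) ≤ 2 ∧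
      1 ≤ N.degIn (insert x l.toFinset) x with hcore
  set Q : V → List V → Prop := fun b l => (core l ∧ b ∉ insert x l.toFinset ∧
      N.degIn (insert x l.toFinset) b ≤ 1) ∧ ¬ C b with hQ
  have hmain : Rich (ε / 16 * Fintype.card V) ((1 + (p - 2)) + 1) fun l =>
      Many (ε / 16 * Fintype.card V) fun b => Q b l := by
    refine hfar'.mono (by linarith) ?_
    rintro t ⟨⟨hxt, hCt⟩, htx⟩
    have htx' : t ≠ x := by simpa using htx
    have hxtc : ({x, t} : Finset V).card = 2 := Finset.card_pair htx'.symm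
    have hw : N.weight {x, t} = 0 := by rw [weight_pair htx'.symm, hxt]
    have hchain := rich_isChain_zero (s := s) (by omega) hε hdeg hn (p - 2) (B := {x, t})
      (by omega) (by omega)
    have hsplit : Rich (ε / 8 * Fintype.card V) (p - 2) fun l =>
        (N.IsChain 0 {x, t} l ∧
          Many (ε / 4 * Fintype.card V) fun z => N.degIn ({x, t} ∪ l.toFinset) z = 0) ∨
        (N.IsChain 0 {x, t} l ∧
          ¬ Many (ε / 4 * Fintype.card V) fun z => N.degIn ({x, t} ∪ l.toFinset) z = 0) :=
      hchain.mono le_rfl fun l _ hl => by tauto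
    have hhalf : ε / 8 * Fintype.card V / 2 = ε / 16 * (Fintype.card V : ℝ) := by ring
    -- If the `p`-set often has many vertices without edges to it, then `t` is reachable, contrary
    -- to its choice. Otherwise `many_private` supplies `a` whose only edge to the set goes to `x`.
    rcases hsplit.or with hbig | hsmall
    · rw [hhalf] at hbig
      exact absurd ((rich_gadget_of_big_zero hp hs hε hdeg hn htx' hxt hbig).mono hle
        fun _ _ h => h) hCt
    rw [hhalf] at hsmall
    refine (hsmall.append (m := 1) (Q := fun l l' => ∃ a, l' = [a] ∧
      (N.degIn ({x, t} ∪ l.toFinset) a = 1 ∧ N.mult x a = 1) ∧ a ∉ {x, t} ∪ l.toFinset)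
      fun l hl hP => ?_).mono le_rfl ?_
    · obtain ⟨-, -, h3, -⟩ := hP.1.spec zero_le_one subset_rfl (isForestOn_of_weight_eq_zero hw)
      have hpriv := many_private (s := s) (by omega) hε hdeg (T := {x, t} ∪ l.toFinset) (x := x)
        (by simp) (by omega) hP.2
      exact (havoid (B := {x, t} ∪ l.toFinset) hpriv (by omega)).mono (by linarith)
        fun a ha => ⟨a, rfl, ha⟩
    · rintro _ - ⟨l, _, rfl, hl, -, ⟨hch, hsm⟩, a, rfl, ⟨ha1, hax⟩, haT⟩
      obtain ⟨f1, f2, f3, f4⟩ := hch.spec zero_le_one subset_rfl (isForestOn_of_weight_eq_zero hw)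
      have hK : insert x (t :: (l ++ [a])).toFinset = insert a ({x, t} ∪ l.toFinset) := by
        ext u
        simp only [List.toFinset_append, List.toFinset_cons, List.toFinset_nil, Finset.mem_union,
          Finset.mem_insert, Finset.mem_singleton, List.mem_toFinset, Finset.notMem_empty, or_false]
        tauto
      have hKc : (insert a ({x, t} ∪ l.toFinset)).card = p + 1 := by
        rw [Finset.card_insert_of_notMem haT]; omega
      have hxl : x ∉ t :: (l ++ [a]) := by
        simp only [List.mem_cons, List.mem_append, List.not_mem_nil, or_false, not_or]
        refine ⟨htx'.symm, fun h => f4 x h (by simp), ?_⟩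
        rintro rfl
        simp at haT
      have hcore' : core (t :: (l ++ [a])) := by
        refine ⟨hxl, ?_⟩
        rw [hK]
        refine ⟨f1.insert_of_le ha1.le, hKc, ?_, ?_⟩
        · rw [weight_insert haT]; omega
        · exact hax.ge.trans (mult_le_degIn (by simp) x)
      -- The `p + 1` vertices have average degree sum at most `(s + 3) / s ≤ 10 / 7`, and few
      -- vertices send no edge, so about `2 - 10 / 7` of all vertices send at most one.
      have hcount : Many ((4 / 7 + ε / 4) * Fintype.card V) fun b =>
          N.degIn (insert a ({x, t} ∪ l.toFinset)) b ≤ 1 := by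
        have h := mul_card_le_of_pointwise (a := 2) (b := 1) (c := 2)
          (f := N.degIn (insert a ({x, t} ∪ l.toFinset)))
          (p := fun b => N.degIn (insert a ({x, t} ∪ l.toFinset)) b ≤ 1)
          (q := fun b => N.degIn ({x, t} ∪ l.toFinset) b = 0) (fun b => by
            have := degIn_mono (N := N) (Finset.subset_insert a ({x, t} ∪ l.toFinset)) b
            omega)
        have h1 := sum_degIn_le hdeg (insert a ({x, t} ∪ l.toFinset))
        rw [hKc] at h1
        have hpR : ((p + 1 : ℕ) : ℝ) = (s + 3) / 2 := by
          have : ((s + 1 : ℕ) : ℝ) = (2 * p : ℕ) := by exact_mod_cast hs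
          push_cast at this ⊢
          linarith
        rw [hpR] at h1
        have h2 : ((s : ℝ) + 3) / 2 * ((2 / s - ε) * Fintype.card V) ≤
            (10 / 7 - 5 * ε) * Fintype.card V := by
          rw [← mul_assoc]
          refine mul_le_mul_of_nonneg_right ?_ hV'.le
          have e1 : ((s : ℝ) + 3) / 2 * (2 / s) = 1 + 3 / 2 * (2 / s) := by field_simp
          nlinarith
        unfold Many at hsm ⊢
        push Not at hsm
        push_cast at h h1
        linarith
      have hcount' := havoid (B := insert a ({x, t} ∪ l.toFinset))
        ((hcount.diff hnot).mono (by linarith) fun _ h => h) (by omega)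
      refine hcount'.mono (by linarith) ?_
      rintro b ⟨⟨hb1, hbC⟩, hbK⟩
      refine ⟨⟨hcore', ?_, ?_⟩, hbC⟩
      · rwa [hK]
      · rwa [hK]
  rw [show 1 + (p - 2) + 1 = p by omega] at hmain
  -- Gadgets need `b` fixed before the list is chosen, hence the change of order.
  obtain ⟨b, hb⟩ := (Rich.swap (by positivity) (by linarith) hmain).exists hpos
  obtain ⟨l, hl⟩ := hb.exists hpos
  refine hl.2 (rich_gadget_of_rich_attached hp hs hε hdeg hn (hle.trans (by linarith))
    (hb.mono le_rfl fun l _ hl => ?_))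
  obtain ⟨⟨⟨h1, h2, h3, h4, h5⟩, h6, h7⟩, -⟩ := hl
  exact ⟨h1, h2, h3, h4, h5, h6, h7⟩

/-- Take disjoint gadgets `l` for `x, w` and `l'` for `y, w`. With `x` present, `w` goes to `l'`;
with `y` present, it goes to `l`. -/
theorem rich_gadget_trans {G : Finset V → Prop} {c c₀ : ℝ} {k : ℕ} {x y : V} (hxy : x ≠ y)
    (h : Many c₀ fun w => Rich c₀ k (Gadget G x w) ∧ Rich c₀ k (Gadget G y w))
    (hc : c + 2 * k + 3 ≤ c₀) : Rich c ((k + k) + 1) (Gadget G x y) := by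
  have hk0 : (0 : ℝ) ≤ k := Nat.cast_nonneg k
  have hxyc : ({x, y} : Finset V).card = 2 := Finset.card_pair hxy
  refine (h.avoid {x, y}).mono (by rw [hxyc]; push_cast; linarith) ?_
  rintro w ⟨⟨hxw, hyw⟩, hw⟩
  have hwc : (insert w {x, y} : Finset V).card = 3 := by
    rw [Finset.card_insert_of_notMem hw, hxyc]
  refine (((hxw.avoid (insert w {x, y})).mono (c' := c) ?_ fun _ _ h => h).append (Q := fun l l' =>
    Gadget G y w l' ∧ l'.Nodup ∧ ∀ v ∈ l', v ∉ insert w {x, y} ∪ l.toFinset)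
      fun l hl hP => ?_).mono le_rfl ?_
  · rw [hwc]; push_cast; linarith
  · refine (hyw.avoid (insert w {x, y} ∪ l.toFinset)).mono ?_ fun _ _ h => h
    have h1 : (insert w {x, y} ∪ l.toFinset).card ≤ 3 + k :=
      (Finset.card_union_le _ _).trans (by have := l.toFinset_card_le; omega)
    have h2 : ((insert w {x, y} ∪ l.toFinset).card : ℝ) ≤ 3 + k := by exact_mod_cast h1
    linarith
  · rintro _ - ⟨l, l', rfl, -, -, ⟨⟨g1, g2⟩, -, hl⟩, ⟨g3, g4⟩, -, hl'⟩
    simp only [Finset.mem_insert, Finset.mem_singleton, Finset.mem_union, List.mem_toFinset,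
      not_or] at hl hl' hw
    constructor
    · have heq : insert x (w :: (l ++ l')).toFinset = insert x l.toFinset ∪ insert w l'.toFinset := by
        ext u
        simp only [List.toFinset_append, List.toFinset_cons, Finset.mem_union, Finset.mem_insert]
        tauto
      rw [heq]
      refine g1.disjUnion g4 (Finset.disjoint_left.2 fun u hu hu' => ?_)
      simp only [Finset.mem_insert, List.mem_toFinset] at hu hu'
      rcases hu with rfl | hu <;> rcases hu' with rfl | hu'
      · exact hw.1 rfl
      · exact (hl' u hu').1.2.1 rfl
      · exact (hl u hu).1 rfl
      · exact (hl' u hu').2 hu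
    · have heq : insert y (w :: (l ++ l')).toFinset = insert w l.toFinset ∪ insert y l'.toFinset := by
        ext u
        simp only [List.toFinset_append, List.toFinset_cons, Finset.mem_union, Finset.mem_insert]
        tauto
      rw [heq]
      refine g2.disjUnion g3 (Finset.disjoint_left.2 fun u hu hu' => ?_)
      simp only [Finset.mem_insert, List.mem_toFinset] at hu hu'
      rcases hu with rfl | hu <;> rcases hu' with rfl | hu'
      · exact hw.2 rfl
      · exact (hl' u hu').1.1 rfl
      · exact (hl u hu).2.2 rfl
      · exact (hl' u hu').2 hu

theorem Many.and {p q : V → Prop} {a : ℝ} (hp : Many (a * Fintype.card V) p)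
    (hq : Many (a * Fintype.card V) q) :
    Many ((2 * a - 1) * Fintype.card V) fun v => p v ∧ q v := by
  unfold Many at *
  have h1 := Set.ncard_union_add_ncard_inter {v | p v} {v | q v}
  have h2 : ({v | p v} ∪ {v | q v}).ncard ≤ Fintype.card V := by
    rw [← Nat.card_eq_fintype_card, ← Set.ncard_univ]
    exact Set.ncard_le_ncard (Set.subset_univ _) (Set.toFinite _)
  have h3 : {v | p v}.ncard + {v | q v}.ncard ≤
      Fintype.card V + {v | p v ∧ q v}.ncard := by
    have : {v | p v} ∩ {v | q v} = {v | p v ∧ q v} := rfl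
    rw [this] at h1
    omega
  have h4 : ({v | p v}.ncard : ℝ) + {v | q v}.ncard ≤
      Fintype.card V + {v | p v ∧ q v}.ncard := by exact_mod_cast h3
  linarith

end OddReachLarge

/-! ### From forests in the complement back to acceptable cliques. -/

section Translation

variable {V : Type*} [DecidableEq V]

theorem compl_induce (M : StdMultigraph V) (K : Finset V) :
    (M.induce K).compl = M.compl.induce K := by
  ext x y
  by_cases h : x = y
  · rw [h, StdMultigraph.loopless, StdMultigraph.loopless]
  · have h' : (x : V) ≠ y := fun e => h (Subtype.ext e)
    simp only [compl, induce, if_neg h, if_neg h']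

variable {N : StdMultigraph V}

theorem IsForestOn.mult_le_one {K : Finset V} (hK : N.IsForestOn K) {x y : V} (hx : x ∈ K)
    (hy : y ∈ K) : N.mult x y ≤ 1 := by
  by_cases hxy : x = y
  · rw [hxy, N.loopless]; exact zero_le_one
  · obtain ⟨v, hv, hv'⟩ := hK {x, y} (by simp [Finset.insert_subset_iff, hx, hy]) (by simp)
    simp only [Finset.mem_insert, Finset.mem_singleton] at hv
    simp only [add_zero] at hv'
    rcases hv with rfl | rfl
    · exact (mult_le_degIn (by simp) v).trans hv'
    · rw [N.symm]
      exact (mult_le_degIn (by simp) v).trans hv'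

/-- On the support of a cycle each vertex has two neighbours, so none could be peeled off. A heavy
edge likewise blocks peeling of its two ends. -/
theorem IsForestOn.isAcyclic_induce {K : Finset V} (hK : N.IsForestOn K) :
    (N.induce K).IsAcyclic := by
  classical
  refine ⟨?_, ?_⟩
  · intro u c hc
    set B : Finset V := c.support.toFinset.map (Function.Embedding.subtype _) with hB
    obtain ⟨v, hv, hv'⟩ := hK B (fun w hw => by
      obtain ⟨w, -, rfl⟩ := Finset.mem_map.1 hw
      exact w.2) ⟨u, Finset.mem_map.2 ⟨u, by simp, rfl⟩⟩
    simp only [add_zero] at hv'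
    obtain ⟨w, hw, rfl⟩ := Finset.mem_map.1 hv
    have h2 := hc.ncard_neighborSet_toSubgraph_eq_two (List.mem_toFinset.1 hw)
    obtain ⟨a, b, hab, hset⟩ := Set.ncard_eq_two.1 h2
    have key : ∀ z ∈ c.toSubgraph.neighborSet w, z.1 ∈ B ∧ 1 ≤ N.mult w z := by
      intro z hz
      have hadj : c.toSubgraph.Adj w z := hz
      refine ⟨Finset.mem_map.2 ⟨z, ?_, rfl⟩, ?_⟩
      · rw [List.mem_toFinset, ← SimpleGraph.Walk.mem_verts_toSubgraph]
        exact hadj.snd_mem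
      · have h3 := hadj.adj_sub
        rcases h3 with h | h
        · have : N.mult w z = 2 := h
          omega
        · have : N.mult w z = 1 := h
          omega
    obtain ⟨ha1, ha2⟩ := key a (by rw [hset]; simp)
    obtain ⟨hb1, hb2⟩ := key b (by rw [hset]; simp)
    have hsub : ({a.1, b.1} : Finset V) ⊆ B := by simp [Finset.insert_subset_iff, ha1, hb1]
    have h4 := degIn_mono (N := N) hsub w.1
    have h5 : N.degIn {a.1, b.1} w.1 = N.mult w a + N.mult w b :=
      Finset.sum_pair (fun h => hab (Subtype.ext h))
    have h6 : N.degIn B w.1 ≤ 1 := hv'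
    omega
  · ext x y
    simp only [SimpleGraph.bot_adj, iff_false]
    intro h
    have h1 : N.mult x y = 2 := h
    have := hK.mult_le_one x.2 y.2
    omega

theorem light_adj_iff (M : StdMultigraph V) {K : Finset V} (x y : K) :
    (M.induce K).light.Adj x y ↔ M.compl.mult x y = 1 := by
  change M.mult x y = 1 ↔ M.compl.mult x y = 1
  simp only [compl]
  split_ifs with h
  · simp [h, M.loopless]
  · have := M.le_two x y
    omega

theorem lightDegree_induce (M : StdMultigraph V) {K : Finset V} (hK : M.compl.IsForestOn K)
    (v : K) : (M.induce K).lightDegree v = M.compl.degIn K v := by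
  classical
  unfold lightDegree degIn
  rw [← Finset.sum_coe_sort K fun u => M.compl.mult v u]
  have h1 : (M.induce K).light.neighborSet v =
      ((Finset.univ.filter fun u : K => M.compl.mult v u = 1 : Finset K) : Set K) := by
    ext u
    simp [light_adj_iff]
  rw [h1, Set.ncard_coe_finset, Finset.card_filter]
  refine Finset.sum_congr rfl fun u _ => ?_
  have := hK.mult_le_one v.2 u.2
  split_ifs <;> omega

theorem two_mul_numLight_induce (M : StdMultigraph V) {K : Finset V}
    (hK : M.compl.IsForestOn K) : 2 * (M.induce K).numLight = M.compl.weight K := by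
  classical
  unfold numLight weight
  rw [Set.ncard_eq_toFinset_card', ← SimpleGraph.edgeFinset,
    ← SimpleGraph.sum_degrees_eq_twice_card_edges,
    ← Finset.sum_coe_sort K fun v => M.compl.degIn K v]
  refine Finset.sum_congr rfl fun v _ => ?_
  rw [← lightDegree_induce M hK, lightDegree, Set.ncard_eq_toFinset_card',
    ← SimpleGraph.card_neighborSet_eq_degree, Set.toFinset_card]

/-- Weight at most `s` gives a fit clique. Otherwise `s` degrees, each at least one, sum to at most
`s + 1`, so at most one of them is `2` and none is larger. -/
theorem IsGood.isAcceptable_induce {s : ℕ} {M : StdMultigraph V} {K : Finset V}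
    (h : M.compl.IsGood s K) : IsAcceptable s (M.induce K) := by
  obtain ⟨hcard, hK, hw⟩ := h
  have hfull : (M.induce K).IsFullClique := by
    unfold IsFullClique
    rw [compl_induce]
    exact hK.isAcyclic_induce
  have hc : Fintype.card K = s := by rw [Fintype.card_coe, hcard]
  have hlight := two_mul_numLight_induce M hK
  by_cases hws : M.compl.weight K ≤ s
  · refine Or.inl ⟨hfull, hc.le, le_max_of_le_right ?_⟩
    rw [hc]
    have : ((2 * (M.induce K).numLight : ℕ) : ℝ) ≤ (s : ℕ) := by
      rw [hlight]; exact_mod_cast hws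
    push_cast at this
    linarith
  · obtain ⟨hw1, hd⟩ := hw.resolve_left hws
    have hsum : ∀ B ⊆ K, B.card ≤ ∑ v ∈ B, M.compl.degIn K v := fun B hB => by
      rw [Finset.card_eq_sum_ones]
      exact Finset.sum_le_sum fun v hv => hd v (hB hv)
    refine Or.inr ⟨hfull, hc.le, Or.inr ⟨hc, fun v => ?_, fun v w hv hw => ?_⟩⟩
    · rw [lightDegree_induce M hK]
      have h1 := Finset.add_sum_erase K (fun v => M.compl.degIn K v) v.2
      have h2 := hsum (K.erase v) (Finset.erase_subset _ _)
      have h3 := Finset.card_erase_of_mem v.2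
      unfold weight at hw1
      have h4 := Finset.card_pos.2 ⟨v.1, v.2⟩
      omega
    · rw [lightDegree_induce M hK] at hv hw
      by_contra hvw
      have hvw' : w.1 ∈ K.erase v := Finset.mem_erase.2 ⟨fun h => hvw (Subtype.ext h.symm), w.2⟩
      have h1 := Finset.add_sum_erase K (fun v => M.compl.degIn K v) v.2
      have h1' := Finset.add_sum_erase (K.erase v) (fun v => M.compl.degIn K v) hvw'
      have h2 := hsum ((K.erase v).erase w)
        ((Finset.erase_subset _ _).trans (Finset.erase_subset _ _))
      have h3 := Finset.card_erase_of_mem v.2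
      have h3' := Finset.card_erase_of_mem hvw'
      unfold weight at hw1
      have h4 := Finset.card_pos.2 ⟨w.1, hvw'⟩
      omega

end Translation

/-! ### Choice of constants and assembly. -/

section Main

universe u

theorem exists_rich_gadget {s : ℕ} (hs : 1 ≤ s) {ε : ℝ} (hε : 0 < ε) (hε1 : ε ≤ 1) :
    ∃ (k : ℕ) (δ : ℝ) (n₀ : ℕ), 0 < δ ∧ δ ≤ ε / 8 ∧
      ∀ (V : Type u) [Fintype V] [DecidableEq V] (N : StdMultigraph V), n₀ ≤ Fintype.card V →
        (∀ v, (N.degIn Finset.univ v : ℝ) ≤ (2 / s - ε) * Fintype.card V) →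
        ∀ x y, x ≠ y → Rich (δ * Fintype.card V) k (Gadget (N.IsGood s) x y) := by
  have hlarge : ∀ n : ℕ, ⌈(s + 2) / (ε / 8)⌉₊ ≤ n → (s + 2 : ℝ) ≤ ε / 8 * n := by
    intro n hn
    have := (Nat.le_ceil ((s + 2 : ℝ) / (ε / 8))).trans (Nat.cast_le.2 hn)
    rwa [div_le_iff₀ (by positivity), mul_comm] at this
  rcases Nat.even_or_odd' s with ⟨r, hr | hr⟩
  · refine ⟨s - 1, ε / 8, ⌈(s + 2) / (ε / 8)⌉₊, by positivity, le_rfl, ?_⟩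
    intro V _ _ N hn hdeg x y hxy
    exact rich_gadget_of_even hs hε hdeg (hlarge _ hn) (hr ▸ even_two_mul r) hxy
  · obtain h | h | h | h : r = 0 ∨ r = 1 ∨ r = 2 ∨ 3 ≤ r := by omega
    · subst h
      refine ⟨0, ε / 8, 0, by positivity, le_rfl, ?_⟩
      intro V _ _ N hn hdeg x y hxy
      have hg : ∀ z : V, N.IsGood s {z} := fun z =>
        ⟨by simp [hr], isForestOn_singleton z, Or.inl (by rw [weight_singleton]; omega)⟩
      exact ⟨by simpa using Tileable.of_mem (hg x), by simpa using Tileable.of_mem (hg y)⟩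
    · subst h
      refine ⟨2, ε / 8, ⌈(s + 2) / (ε / 8)⌉₊, by positivity, le_rfl, ?_⟩
      intro V _ _ N hn hdeg x y hxy
      have := hlarge _ hn
      norm_num at hr
      subst hr
      exact rich_gadget_of_eq_three hε hdeg this hxy
    · subst h
      refine ⟨4, ε / 8, ⌈(s + 2) / (ε / 8)⌉₊, by positivity, le_rfl, ?_⟩
      intro V _ _ N hn hdeg x y hxy
      have := hlarge _ hn
      norm_num at hr
      subst hr
      exact rich_gadget_of_eq_five hε hdeg this hxy
    -- The value provided by `many_reach_of_odd` with `p = r + 1`. Half of it is given up so that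
    -- linking through `w` can avoid collisions.
    · set δ := ε / 16 * (ε / 16 / 2) ^ (r + 1) with hδ
      have hδ0 : 0 < δ := by positivity
      have hδ1 : δ ≤ ε / 16 :=
        mul_le_of_le_one_right (by positivity) (pow_le_one₀ (by positivity) (by linarith))
      set k := s - 1 with hk
      refine ⟨k + k + 1, δ / 2, max ⌈(s + 2) / (ε / 8)⌉₊ ⌈(2 * k + 3) / (δ / 2)⌉₊, by positivity,
        by linarith, ?_⟩
      intro V _ _ N hn hdeg x y hxy
      have hn1 := hlarge _ ((le_max_left _ _).trans hn)
      have hn2 : (2 * k + 3 : ℝ) ≤ δ / 2 * Fintype.card V := by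
        have := (Nat.le_ceil ((2 * k + 3 : ℝ) / (δ / 2))).trans
          (Nat.cast_le.2 ((le_max_right _ _).trans hn))
        rwa [div_le_iff₀ (by positivity), mul_comm (Fintype.card V : ℝ)] at this
      have hreach := fun x => many_reach_of_odd (N := N) (s := s) (p := r + 1) (by omega) (by omega)
        hε hε1 hdeg hn1 x
      have hn0 : (0 : ℝ) ≤ Fintype.card V := Nat.cast_nonneg _
      refine rich_gadget_trans hxy (((hreach x).and (hreach y)).mono ?_ fun _ h => h) ?_
      · exact mul_le_mul_of_nonneg_right (by norm_num; linarith) hn0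
      · change (δ / 2 * Fintype.card V + 2 * k + 3 : ℝ) ≤ δ * Fintype.card V
        linarith

theorem exists_pow_lt {r μ : ℝ} (hr0 : 0 ≤ r) (hr1 : r < 1) (hμ : 0 < μ) (s : ℕ) :
    ∃ n₀ : ℕ, ∀ n : ℕ, n₀ ≤ n → r ^ ⌊μ * n⌋₊ * (n : ℝ) ^ s < 1 := by
  have ht := tendsto_pow_const_mul_const_pow_of_abs_lt_one s
    (show |r| < 1 by rwa [abs_of_nonneg hr0])
  have hpos : 0 < (μ / 2) ^ s := by positivity
  obtain ⟨m₀, hm₀⟩ := Filter.eventually_atTop.1 (ht.eventually (gt_mem_nhds hpos))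
  refine ⟨⌈(m₀ + 1) / μ⌉₊, fun n hn => ?_⟩
  have h1 : (m₀ + 1 : ℝ) ≤ μ * n := by
    have := (Nat.le_ceil ((m₀ + 1 : ℝ) / μ)).trans (Nat.cast_le.2 hn)
    rwa [div_le_iff₀ hμ, mul_comm] at this
  set m := ⌊μ * n⌋₊ with hm
  have h2 : m₀ + 1 ≤ m := Nat.le_floor (by push_cast; exact h1)
  have h3 : μ * n < m + 1 := Nat.lt_floor_add_one _
  have h4 := hm₀ m (by omega)
  have h5 : (1 : ℝ) ≤ m := by exact_mod_cast (show 1 ≤ m by omega)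
  have h6 : μ / 2 * n ≤ m := by linarith
  have h7 : (μ / 2) ^ s * (r ^ m * (n : ℝ) ^ s) < (μ / 2) ^ s * 1 := by
    calc (μ / 2) ^ s * (r ^ m * (n : ℝ) ^ s) = r ^ m * (μ / 2 * n) ^ s := by rw [mul_pow]; ring
      _ ≤ r ^ m * (m : ℝ) ^ s := by gcongr
      _ < (μ / 2) ^ s * 1 := by rw [mul_one, mul_comm]; exact h4
  exact lt_of_mul_lt_mul_left h7 hpos.le

theorem exists_tileable_univ {s : ℕ} (hs : 1 ≤ s) {ε : ℝ} (hε : 0 < ε) (hε1 : ε ≤ 1) :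
    ∃ n₀ : ℕ, ∀ (V : Type u) [Fintype V] [DecidableEq V] (N : StdMultigraph V),
      n₀ ≤ Fintype.card V → s ∣ Fintype.card V →
        (∀ v, (N.degIn Finset.univ v : ℝ) ≤ (2 / s - ε) * Fintype.card V) →
        Tileable (N.IsGood s) Finset.univ := by
  obtain ⟨k, δ, n₁, hδ0, hδ1, hreach⟩ := exists_rich_gadget.{u} hs hε hε1
  set K := s * k + s with hK
  have hK0 : (0 : ℝ) < K := by exact_mod_cast (show 0 < K by omega)
  set C := ⌈4 * (2 * s : ℝ) ^ s / (ε / 2)⌉₊ with hC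
  set j := s * C with hj
  set η := δ / 4 with hη
  have hη0 : 0 < η := by positivity
  -- Makes `j + 1` absorbers of `⌊μ * n⌋` lists of length `K` occupy at most `η * n / 2` vertices,
  -- while the number of rounds stays linear, as `exists_pow_lt` requires.
  set μ := η / (2 * (K * (j + 1))) with hμ
  have hμ0 : 0 < μ := by positivity
  have hηK : 0 < η ^ K := by positivity
  have hηK1 : η ^ K ≤ 1 := pow_le_one₀ hη0.le (by linarith)
  obtain ⟨n₂, hn₂⟩ := exists_pow_lt (r := 1 - η ^ K) (by linarith) (by linarith) hμ0 s
  set R : ℝ := 8 * (s + 2) / ε + (2 * s + s * k) / (δ / 2) + K / (η / 2) +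
    16 * (s + s * s * C) / ε with hR
  refine ⟨max (max n₁ n₂) (max 1 ⌈R⌉₊), fun V _ _ N hn hdvd hdeg => ?_⟩
  set n : ℝ := ((Fintype.card V : ℕ) : ℝ) with hnn
  have hn1 : n₁ ≤ Fintype.card V := (le_max_left _ _).trans ((le_max_left _ _).trans hn)
  have hn2 : n₂ ≤ Fintype.card V := (le_max_right _ _).trans ((le_max_left _ _).trans hn)
  have hn3 : 1 ≤ Fintype.card V := (le_max_left _ _).trans ((le_max_right _ _).trans hn)
  have hn4 : R ≤ n := (Nat.le_ceil R).trans
    (Nat.cast_le.2 ((le_max_right _ _).trans ((le_max_right _ _).trans hn)))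
  have hn0 : 0 ≤ n := Nat.cast_nonneg _
  have hsR : (1 : ℝ) ≤ s := by exact_mod_cast hs
  have p1 : 0 ≤ 8 * (s + 2) / ε := by positivity
  have p2 : 0 ≤ (2 * s + s * k) / (δ / 2) := by positivity
  have p3 : 0 ≤ K / (η / 2) := by positivity
  have p4 : 0 ≤ 16 * (s + s * s * C) / ε := by positivity
  have q1 : (s + 2 : ℝ) ≤ ε / 8 * n := by
    have : 8 * (s + 2) / ε ≤ n := by linarith
    rw [div_le_iff₀ hε] at this
    linarith
  have q2 : (2 * s + s * k : ℝ) ≤ δ / 2 * n := by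
    have : (2 * s + s * k) / (δ / 2) ≤ n := by linarith
    rwa [div_le_iff₀ (by positivity), mul_comm n] at this
  have q3 : (K : ℝ) ≤ η / 2 * n := by
    have : K / (η / 2) ≤ n := by linarith
    rwa [div_le_iff₀ (by positivity), mul_comm n] at this
  have q4 : 16 * (s + s * s * C : ℝ) ≤ ε * n := by
    have : 16 * (s + s * s * C) / ε ≤ n := by linarith
    rwa [div_le_iff₀ hε, mul_comm n] at this
  have hclique : Rich (δ * n) s fun l => N.IsGood s l.toFinset :=
    (rich_isGood hs hε (by linarith) hdeg q1).mono (mul_le_mul_of_nonneg_right hδ1 hn0)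
      fun _ _ h => h
  have habs : ∀ Q : Finset V, Q.card = s → Rich (2 * η * n) K (Absorbs (N.IsGood s) Q) :=
    fun Q hQ => rich_absorbs (hreach V N hn1 hdeg) hclique hQ (by rw [hη]; linarith)
  set m := ⌊μ * n⌋₊ with hm
  have hmle : (m : ℝ) ≤ μ * n := Nat.floor_le (by positivity)
  have hmK : (m : ℝ) * (K * (j + 1)) ≤ η / 2 * n := by
    calc (m : ℝ) * (K * (j + 1)) ≤ μ * n * (K * (j + 1)) := by gcongr
      _ = η / 2 * n := by rw [hμ]; field_simp
  obtain ⟨A, hAc, hAt, hA⟩ := exists_multi_absorber hη0.le (by linarith) hn3 habs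
    (hn₂ _ hn2) j (by rw [← hnn]; linarith)
  have hAR : (A.card : ℝ) ≤ ε / 4 * n := by
    have h1 : (A.card : ℝ) ≤ j * (m * K) := by exact_mod_cast hAc
    have h2 : (0 : ℝ) ≤ m * K := by positivity
    have h3 : η * n ≤ ε / 32 * n := mul_le_mul_of_nonneg_right (by linarith) hn0
    have h4 : 0 ≤ ε * n := by positivity
    linarith
  set U := (Finset.univ : Finset V) \ A with hU
  have hUA : U.card + A.card = Fintype.card V := by
    rw [← Finset.card_univ]
    exact Finset.card_sdiff_add_card_eq_card (Finset.subset_univ A)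
  have hUR : (U.card : ℝ) = n - A.card := by
    have : (U.card : ℝ) + A.card = n := by rw [hnn]; exact_mod_cast hUA
    linarith
  have h2s : 2 / (s : ℝ) ≤ 2 := by rw [div_le_iff₀ (by linarith)]; linarith
  have hA0 : (0 : ℝ) ≤ A.card := Nat.cast_nonneg _
  -- Removing `A`, at most `ε * n / 4` vertices, costs no more than half of `ε` in the degree
  -- condition.
  obtain ⟨T, hT1, hT2, hT3⟩ := exists_near_tiling (N := N) (U := U) hs (half_pos hε)
    (show _ ≤ (C : ℝ) from Nat.le_ceil _) (by
      have h1 : 3 / 4 * n ≤ U.card := by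
        rw [hUR]
        have : ε / 4 * n ≤ 1 / 4 * n := mul_le_mul_of_nonneg_right (by linarith) hn0
        linarith
      have h2 : ε / 2 * (3 / 4 * n) ≤ s * (ε / 2 * U.card) :=
        (mul_le_mul_of_nonneg_left h1 (by positivity)).trans
          (le_mul_of_one_le_left (by positivity) hsR)
      have h4 : 0 ≤ ε * n := by positivity
      linarith) (fun v _ => by
      have h1 : (N.degIn U v : ℝ) ≤ N.degIn Finset.univ v :=
        Nat.cast_le.2 (degIn_mono (Finset.subset_univ U) v)
      refine h1.trans ((hdeg v).trans ?_)
      rw [hUR]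
      have h2 : 2 / (s : ℝ) * A.card ≤ 2 * A.card := mul_le_mul_of_nonneg_right h2s hA0
      have h3 : 0 ≤ ε * A.card := by positivity
      linarith)
  set W := U \ T.biUnion id with hW
  have hTU : T.biUnion id ⊆ U := Finset.biUnion_subset.2 fun K hK => (hT2 K hK).1
  have hTt : Tileable (N.IsGood s) (T.biUnion id) :=
    Tileable.biUnion hT1 fun K hK => IsGood.of_fit (hT2 K hK).2.2 (hT2 K hK).2.1
  have hWc : W.card + (T.biUnion id).card = U.card := Finset.card_sdiff_add_card_eq_card hTU
  have hWA : Disjoint W A := Finset.sdiff_disjoint.mono_left Finset.sdiff_subset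
  obtain ⟨i, hi⟩ : s ∣ W.card := by
    have d1 := hAt.dvd_card (s := s) fun K hK => hK.1
    have d2 := hTt.dvd_card (s := s) fun K hK => hK.1
    have d3 : s ∣ W.card + ((T.biUnion id).card + A.card) := by
      have : W.card + ((T.biUnion id).card + A.card) = Fintype.card V := by omega
      rwa [this]
    exact (Nat.dvd_add_left (d2.add d1)).1 d3
  have hij : i ≤ j := by
    rw [hi] at hT3
    exact Nat.le_of_mul_le_mul_left hT3 hs
  have hAW := hA i hij W (by rw [hi, mul_comm]) hWA
  have hfin := hTt.disjUnion hAW (Finset.disjoint_union_right.2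
    ⟨Finset.sdiff_disjoint.mono_left hTU, Finset.disjoint_sdiff⟩)
  have huniv : T.biUnion id ∪ (A ∪ W) = Finset.univ := by
    ext v
    simp only [hW, hU, Finset.mem_union, Finset.mem_sdiff, Finset.mem_univ, true_and, iff_true]
    tauto
  rwa [huniv] at hfin

end Main

end StdMultigraph

theorem mainTheorem3 (s : ℕ) (hs : 1 ≤ s) (ε : ℝ) (hε : 0 < ε) :
    ∃ n₀ : ℕ, ∀ (V : Type*) [Fintype V] (M : StdMultigraph V) (n : ℕ),
      Fintype.card V = n → n₀ ≤ n → s ∣ n →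
      2 * (1 - 1 / (s : ℝ)) * (n : ℝ) + ε * (n : ℝ) ≤ (M.minDegree : ℝ) →
      ∃ T : Finset (Finset V), M.IsPerfectAcceptableTiling s T := by
  classical
  -- Replacing `ε` by `min ε 1` only weakens the degree condition.
  obtain ⟨n₀, hn₀⟩ := StdMultigraph.exists_tileable_univ hs (lt_min hε one_pos) (min_le_right ε 1)
  refine ⟨n₀, fun V _ M n hVn hn hdvd hδ => ?_⟩
  subst hVn
  have htile := hn₀ V M.compl hn hdvd fun v => by
    have h1 : M.minDegree ≤ M.degree v := ciInf_le (OrderBot.bddBelow _) v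
    have h2 : M.compl.degIn Finset.univ v + M.degree v ≤ 2 * Fintype.card V := by
      unfold StdMultigraph.degIn StdMultigraph.degree
      rw [← Finset.sum_add_distrib, mul_comm, ← smul_eq_mul, ← Finset.card_univ]
      refine Finset.sum_le_card_nsmul _ _ _ fun w _ => ?_
      simp only [StdMultigraph.compl]
      split_ifs with h
      · rw [zero_add]; exact M.le_two v w
      · have := M.le_two v w
        omega
    have h1' : (M.minDegree : ℝ) ≤ M.degree v := by exact_mod_cast h1
    have h2' : (M.compl.degIn Finset.univ v : ℝ) + M.degree v ≤ 2 * Fintype.card V := by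
      exact_mod_cast h2
    have h3 : min ε 1 * (Fintype.card V : ℝ) ≤ ε * Fintype.card V :=
      mul_le_mul_of_nonneg_right (min_le_left _ _) (Nat.cast_nonneg _)
    have h4 : 2 * (1 - 1 / (s : ℝ)) * (Fintype.card V : ℝ) =
        2 * Fintype.card V - 2 / s * Fintype.card V := by ring
    linarith
  obtain ⟨T, hT1, hT2, hT3⟩ := htile.exists_partition
  refine ⟨T, hT1, fun v => ?_, fun S hS => ⟨(hT3 S hS).1, (hT3 S hS).isAcceptable_induce⟩⟩
  have hv : v ∈ T.biUnion id := by rw [hT2]; exact Finset.mem_univ v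
  exact Finset.mem_biUnion.1 hv
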